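/- Fix an integer $n \ge 0$ and let $w = w_1 w_2 \cdots w_n \in S_n$ be a permutation of $\{1,\ldots,n\}$. The Schubert polynomials $\mathfrak{S}_w(x) = \mathfrak{S}_w(x_1,\ldots,x_n) \in \mathbb{Z}[x_1,\ldots,x_n]$, $w \in S_n$, are defined by $\mathfrak{S}_{w_0}(x) = x_1^{n-1}x_2^{n-2}\cdots x_{n-1}$ for $w_0 = n\cdots 21$, and, for $w \ne w_0$, by $\mathfrak{S}_w = \partial_i \mathfrak{S}_{ws_i}$ for any position $i$ with $w_i < w_{i+1}$ (the result does not depend on the choice of $i$). Here $ws_i$ is obtained from $w$ by interchanging $w_i$ and $w_{i+1}$, and $\partial_i f = \dfrac{f - s_i f}{x_i - x_{i+1}}$, where $s_i f$ is obtained from $f$ by exchanging $x_i$ and $x_{i+1}$. A rational function in $x_1, x_2, \ldots$ is called *a Schubert polynomial* if it equals $\mathfrak{S}_v(x)$ for some $m \ge 0$ and some $v \in S_m$. Let $\delta_n = (n-1, n-2, \ldots, 1, 0)$. The complement of $\mathfrak{S}_w$ with respect to $\delta_n$ is $$x^{\delta_n}\,\mathfrak{S}_w(x^{-1}) = x_1^{n-1}x_2^{n-2}\cdots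 x_{n-1}\;\mathfrak{S}_w(x_1^{-1},\ldots,x_n^{-1}).$$ Say that $w$ avoids $132$ if there are no $i<j<k$ with $w_i<w_k<w_j$, and that $w$ avoids $312$ if there are no $i<j<k$ with $w_j<w_k<w_i$. **Theorem.** The complement $x^{\delta_n}\mathfrak{S}_w(x^{-1})$ is a Schubert polynomial if and only if $w$ avoids both $132$ and $312$. Moreover, whenever it is a Schubert polynomial, $x^{\delta_n}\mathfrak{S}_w(x^{-1}) = \mathfrak{S}_{w^c}(x)$, where $w^c \in S_n$ is given by $w^c_i = n+1-w_i$ for $1 \le i \le n$. -/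

import Mathlib

/-! Conventions. Everything is indexed from `0`: a permutation `w₁ w₂ ⋯ wₙ` of `{1, …, n}` is a
`w : Equiv.Perm (Fin n)` with `wᵢ = w (i - 1) + 1`, and the variable `xᵢ` is `X (i - 1)` in the
polynomial ring `MvPolynomial ℕ ℤ = ℤ[x₁, x₂, …]`, which contains every `ℤ[x₁, …, xₙ]`.
The product `w * Equiv.swap i j` swaps the entries in the positions `i` and `j`. -/

namespace SchubertComplement

open MvPolynomial

/-- The polynomial `sᵢ f`: exchange the variables `X i` and `X (i + 1)` in `f`. -/
noncomputable def swapVars (i : ℕ) (f : MvPolynomial ℕ ℤ) : MvPolynomial ℕ ℤ :=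
  rename (Equiv.swap i (i + 1)) f

theorem sub_dvd_sub_swapVars (i : ℕ) (f : MvPolynomial ℕ ℤ) :
    (X i - X (i + 1) : MvPolynomial ℕ ℤ) ∣ f - swapVars i f := by
  unfold swapVars
  induction f using MvPolynomial.induction_on with
  | C a => simp
  | add p q hp hq =>
    have h := dvd_add hp hq
    rw [map_add]
    convert h using 1
    ring
  | mul_X p k hp =>
    have hX : (X i - X (i + 1) : MvPolynomial ℕ ℤ) ∣
        X k - X (Equiv.swap i (i + 1) k) := by
      rcases eq_or_ne k i with rfl | h1
      · simp
      · rcases eq_or_ne k (i + 1) with rfl | h2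
        · rw [Equiv.swap_apply_right, ← neg_sub (X i)]
          exact (dvd_neg.mpr dvd_rfl)
        · rw [Equiv.swap_apply_of_ne_of_ne h1 h2]
          simp
    have h := dvd_add (hp.mul_right (X k))
      (hX.mul_left (rename (Equiv.swap i (i + 1)) p))
    rw [map_mul, rename_X]
    convert h using 1
    ring

/-- The divided difference `∂ᵢ f = (f - sᵢ f) / (X i - X (i + 1))`: the exact quotient. -/
noncomputable def dividedDifference (i : ℕ) (f : MvPolynomial ℕ ℤ) : MvPolynomial ℕ ℤ :=
  Classical.choose (sub_dvd_sub_swapVars i f)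

theorem mul_dividedDifference (i : ℕ) (f : MvPolynomial ℕ ℤ) :
    (X i - X (i + 1)) * dividedDifference i f = f - swapVars i f :=
  (Classical.choose_spec (sub_dvd_sub_swapVars i f)).symm

/-- The staircase `δₙ = (n - 1, …, 1, 0)`, extended by zeros. (The truncated subtraction is
what makes the extension zero.) -/
noncomputable def staircase (n : ℕ) : ℕ →₀ ℕ :=
  Finsupp.onFinset (Finset.range n) (fun i => n - 1 - i)
    (fun i hi => Finset.mem_range.mpr (by omega))

/-- The position `i` (and `i + 1`) of `w` is an ascent. -/
def IsAscent {n : ℕ} (w : Equiv.Perm (Fin n)) (i : ℕ) : Prop :=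
  ∃ hi : i + 1 < n, w ⟨i, Nat.lt_of_succ_lt hi⟩ < w ⟨i + 1, hi⟩

instance {n : ℕ} (w : Equiv.Perm (Fin n)) : DecidablePred (IsAscent w) := fun i =>
  inferInstanceAs (Decidable (∃ hi : i + 1 < n, w ⟨i, Nat.lt_of_succ_lt hi⟩ < w ⟨i + 1, hi⟩))

/-- Every permutation other than `w₀ = n ⋯ 2 1` has an ascent. -/
theorem exists_isAscent {n : ℕ} {w : Equiv.Perm (Fin n)} (hw : w ≠ Fin.revPerm) :
    ∃ i, IsAscent w i := by
  by_contra hcon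
  apply hw
  have hanti : StrictAnti w := by
    cases n with
    | zero => intro a; exact a.elim0
    | succ k =>
      rw [Fin.strictAnti_iff_succ_lt]
      intro i
      by_contra hlt
      apply hcon
      refine ⟨i, by omega, ?_⟩
      refine lt_of_le_of_ne (not_lt.mp hlt) ?_
      intro h
      have := congrArg Fin.val (w.injective h)
      simp at this
  have hmono : StrictMono (Fin.revPerm * w : Equiv.Perm (Fin n)) := by
    intro a b hab
    simpa using hanti hab
  have hid : ∀ a, (Fin.revPerm * w : Equiv.Perm (Fin n)) a = a := by
    intro a
    have := Subsingleton.elim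
      (StrictMono.orderIsoOfSurjective _ hmono (Equiv.surjective _)) (OrderIso.refl (Fin n))
    exact congrArg (fun e : Fin n ≃o Fin n => e a) this
  ext a
  have h := congrArg Fin.rev (hid a)
  simp only [Equiv.Perm.mul_apply, Fin.revPerm_apply, Fin.rev_rev] at h
  rw [h, Fin.revPerm_apply]

/-- A quantity that drops when the two entries of an ascent are swapped. -/
theorem sum_mul_swap_lt {n : ℕ} (w : Equiv.Perm (Fin n)) (a b : Fin n) (hab : a < b)
    (hw : w a < w b) :
    ∑ i : Fin n, (i : ℕ) * ((w * Equiv.swap a b) i : ℕ) < ∑ i : Fin n, (i : ℕ) * (w i : ℕ) := by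
  have hne : a ≠ b := hab.ne
  have hb : b ∈ Finset.univ.erase a := by simp [hne.symm]
  rw [← Finset.add_sum_erase _ _ (Finset.mem_univ a), ← Finset.add_sum_erase _ _ hb,
    ← Finset.add_sum_erase _ _ (Finset.mem_univ a), ← Finset.add_sum_erase _ _ hb]
  have hrest : ∑ i ∈ (Finset.univ.erase a).erase b, (i : ℕ) * ((w * Equiv.swap a b) i : ℕ)
      = ∑ i ∈ (Finset.univ.erase a).erase b, (i : ℕ) * (w i : ℕ) := by
    refine Finset.sum_congr rfl fun i hi => ?_
    simp only [Finset.mem_erase] at hi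
    rw [Equiv.Perm.mul_apply, Equiv.swap_apply_of_ne_of_ne hi.2.1 hi.1]
  rw [hrest]
  simp only [Equiv.Perm.mul_apply, Equiv.swap_apply_left, Equiv.swap_apply_right]
  have h1 : (a : ℕ) < b := hab
  have h2 : (w a : ℕ) < w b := hw
  nlinarith

/-- The Schubert polynomial of `w ∈ Sₙ`. For `w₀ = n ⋯ 2 1` it is `x₁ⁿ⁻¹ x₂ⁿ⁻² ⋯ xₙ₋₁`; for every
other `w` it is `∂ᵢ` of the Schubert polynomial of `w sᵢ`, where `i` is an ascent of `w`
(the value does not depend on which one; the first ascent is taken). -/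
noncomputable def schubert {n : ℕ} (w : Equiv.Perm (Fin n)) : MvPolynomial ℕ ℤ :=
  if hw : w = Fin.revPerm then
    monomial (staircase n) 1
  else
    have h := exists_isAscent hw
    have hi : Nat.find h + 1 < n := (Nat.find_spec h).1
    dividedDifference (Nat.find h)
      (schubert (w * Equiv.swap ⟨Nat.find h, Nat.lt_of_succ_lt hi⟩ ⟨Nat.find h + 1, hi⟩))
termination_by ∑ i : Fin n, (i : ℕ) * (w i : ℕ)
decreasing_by
  exact sum_mul_swap_lt w _ _ (Fin.mk_lt_mk.mpr (Nat.lt_succ_self _)) (Nat.find_spec h).2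

/-- The field of rational functions `ℚ(x₁, x₂, …)`, as the fraction field of `ℤ[x₁, x₂, …]`. -/
abbrev RatField : Type := FractionRing (MvPolynomial ℕ ℤ)

/-- The complement `x^μ f(x⁻¹)` of a polynomial `f` with respect to `μ`, a rational function. -/
noncomputable def complement (μ : ℕ →₀ ℕ) (f : MvPolynomial ℕ ℤ) : RatField :=
  algebraMap (MvPolynomial ℕ ℤ) RatField (monomial μ 1) *
    aeval (fun i => (algebraMap (MvPolynomial ℕ ℤ) RatField (X i))⁻¹) f

/-- The rational function `g` is a Schubert polynomial, of a permutation in some `Sₘ`. -/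
def IsSchubert (g : RatField) : Prop :=
  ∃ (m : ℕ) (v : Equiv.Perm (Fin m)), g = algebraMap (MvPolynomial ℕ ℤ) RatField (schubert v)

/-- There are no positions `i < j < k` with `wᵢ < wₖ < wⱼ`. -/
def Avoids132 {n : ℕ} (w : Equiv.Perm (Fin n)) : Prop :=
  ¬ ∃ i j k : Fin n, i < j ∧ j < k ∧ w i < w k ∧ w k < w j

/-- There are no positions `i < j < k` with `wⱼ < wₖ < wᵢ`. -/
def Avoids312 {n : ℕ} (w : Equiv.Perm (Fin n)) : Prop :=
  ¬ ∃ i j k : Fin n, i < j ∧ j < k ∧ w j < w k ∧ w k < w i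

/-- The permutation `w^c` with `w^c_i = n + 1 - w_i`; counted from `0`, `w^c i = n - 1 - w i`. -/
def permComplement {n : ℕ} (w : Equiv.Perm (Fin n)) : Equiv.Perm (Fin n) :=
  Fin.revPerm * w

end SchubertComplement

/-!
If `w` avoids 132, then `𝔖 w` is the single monomial `x ^ code w`
(`schubert_eq_monomial_of_avoids132`). If `w` avoids 132 and 312, then both `w` and its complement
`w^c` avoid 132, and the codes of `w` and `w^c` add up to the staircase, so the complement of `𝔖 w`
is `𝔖 w^c` (`complement_schubert_of_avoids`).

For the converse, expand Schubert polynomials in powers of `x₁`. Positions and values are counted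
from `0`. The lowest power of `x₁` in `𝔖 w` is `w 0`, with coefficient the Schubert polynomial of
the pattern `tail w` of the remaining entries (`slice_schubert_of_le`). The highest power is the
number `N w` of positions that are not left-to-right maxima, with coefficient the Schubert polynomial
of the permutation `lowerRecords w` with entries `min (w (k + 1)) (max (w 0, …, w k))`
(`slice_schubert_of_ge`). Both facts are proved by induction on the length: a polynomial is determined
by its divided differences up to a constant (`eq_of_dividedDifference_eq`), divided differences in
`x₂, x₃, …` act on each power of `x₁` separately, and the constants are the coefficients of pure powers
of `x₁`, which satisfy a recursion of their own (`restrictAxis_schubert`).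

Suppose now that the complement of `𝔖 w` is `𝔖 v`. Then `v` may be taken in the same symmetric group
(`exists_schubert_eq_of_le_staircase`). Taking complements exchanges the lowest and the highest power
of `x₁`, so `v 0 + N w = w 0 + N v = n - 1`, and `lowerRecords w`, `tail v` as well as
`lowerRecords v`, `tail w` are pairs of the same kind in a smaller symmetric group. By induction all
four avoid both patterns, so that `N u = u 0` for each of them. Comparing first entries then gives
`|w 0 - w 1| = 1`, and prepending such an entry to `tail w` creates no pattern
(`avoids_of_isComplementPair`).
-/

namespace SchubertComplement

open MvPolynomial

/-! ### Divided differences -/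

theorem X_sub_X_succ_ne_zero (i : ℕ) : (X i - X (i + 1) : MvPolynomial ℕ ℤ) ≠ 0 := by
  rw [sub_ne_zero]
  intro h
  have := X_injective h
  omega

theorem dividedDifference_eq_of_mul_eq {i : ℕ} {f g : MvPolynomial ℕ ℤ}
    (h : (X i - X (i + 1)) * g = f - swapVars i f) : dividedDifference i f = g :=
  mul_left_cancel₀ (X_sub_X_succ_ne_zero i) ((mul_dividedDifference i f).trans h.symm)

theorem dividedDifference_sub (i : ℕ) (f g : MvPolynomial ℕ ℤ) :
    dividedDifference i (f - g) = dividedDifference i f - dividedDifference i g := by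
  apply dividedDifference_eq_of_mul_eq
  rw [mul_sub, mul_dividedDifference, mul_dividedDifference]
  simp only [swapVars, map_sub]
  ring

theorem dividedDifference_eq_zero_iff (i : ℕ) (f : MvPolynomial ℕ ℤ) :
    dividedDifference i f = 0 ↔ swapVars i f = f := by
  constructor
  · intro h
    have := mul_dividedDifference i f
    rw [h, mul_zero] at this
    exact (sub_eq_zero.mp this.symm).symm
  · intro h
    apply dividedDifference_eq_of_mul_eq
    rw [h]; simp

@[simp] theorem dividedDifference_zero (i : ℕ) : dividedDifference i 0 = 0 := by
  rw [dividedDifference_eq_zero_iff]; simp [swapVars]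

theorem swapVars_swapVars (i : ℕ) (f : MvPolynomial ℕ ℤ) : swapVars i (swapVars i f) = f := by
  simp only [swapVars, rename_rename]
  rw [show (Equiv.swap i (i + 1) : ℕ → ℕ) ∘ Equiv.swap i (i + 1) = id by ext; simp, rename_id_apply]

theorem swapVars_dividedDifference (i : ℕ) (f : MvPolynomial ℕ ℤ) :
    swapVars i (dividedDifference i f) = dividedDifference i f := by
  symm
  apply dividedDifference_eq_of_mul_eq
  have h := congrArg (swapVars i) (mul_dividedDifference i f)
  have h2 : swapVars i (f - swapVars i f) = swapVars i f - f := by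
    have := swapVars_swapVars i f
    simp only [swapVars] at this ⊢
    rw [map_sub, this]
  rw [h2] at h
  simp only [swapVars, map_mul, map_sub, rename_X, Equiv.swap_apply_left,
    Equiv.swap_apply_right] at h
  simp only [swapVars]
  linear_combination -h

theorem swapVars_comm {i j : ℕ} (hij : i + 1 < j) (f : MvPolynomial ℕ ℤ) :
    swapVars i (swapVars j f) = swapVars j (swapVars i f) := by
  simp only [swapVars, rename_rename]
  congr 2
  rw [← Equiv.Perm.coe_mul, ← Equiv.Perm.coe_mul]
  congr 1
  apply Equiv.Perm.Disjoint.commute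
  intro x
  by_cases h : x = i ∨ x = i + 1
  · right; apply Equiv.swap_apply_of_ne_of_ne <;> omega
  · left; apply Equiv.swap_apply_of_ne_of_ne <;> omega

theorem swapVars_braid (i : ℕ) (f : MvPolynomial ℕ ℤ) :
    swapVars i (swapVars (i + 1) (swapVars i f)) =
      swapVars (i + 1) (swapVars i (swapVars (i + 1) f)) := by
  simp only [swapVars, rename_rename]
  congr 2
  ext x
  simp only [Function.comp_apply, Equiv.swap_apply_def]
  split_ifs <;> omega

theorem dividedDifference_comm {i j : ℕ} (hij : i + 1 < j) (f : MvPolynomial ℕ ℤ) :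
    dividedDifference i (dividedDifference j f) = dividedDifference j (dividedDifference i f) := by
  apply dividedDifference_eq_of_mul_eq
  apply mul_left_cancel₀ (X_sub_X_succ_ne_zero j)
  set g := dividedDifference j f with hg
  set h := dividedDifference i f with hh
  have e1 := mul_dividedDifference j h
  have e2 := mul_dividedDifference i f
  have e3 := mul_dividedDifference j f
  have e4 := congrArg (swapVars i) e3
  have e5 := congrArg (swapVars j) e2
  rw [← hg] at e3 e4
  rw [← hh] at e2 e5
  have a1 : Equiv.swap i (i + 1) j = j := Equiv.swap_apply_of_ne_of_ne (by omega) (by omega)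
  have a2 : Equiv.swap i (i + 1) (j + 1) = j + 1 :=
    Equiv.swap_apply_of_ne_of_ne (by omega) (by omega)
  have a3 : Equiv.swap j (j + 1) i = i := Equiv.swap_apply_of_ne_of_ne (by omega) (by omega)
  have a4 : Equiv.swap j (j + 1) (i + 1) = i + 1 :=
    Equiv.swap_apply_of_ne_of_ne (by omega) (by omega)
  have c := swapVars_comm hij f
  simp only [swapVars, map_mul, map_sub, rename_X, a1, a2, a3, a4] at e1 e2 e3 e4 e5 c ⊢
  linear_combination (X i - X (i + 1)) * e1 - e3 + e4 + e2 - e5 - c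

/-- Both sides of the braid relation are, up to the Vandermonde factor, the antisymmetrization of
`f` in three consecutive variables. This is the left-hand side. -/
theorem vandermonde_mul_dividedDifference_left (i : ℕ) (f : MvPolynomial ℕ ℤ) :
    (X i - X (i + 1)) * (X i - X (i + 2)) * (X (i + 1) - X (i + 2)) *
      dividedDifference i (dividedDifference (i + 1) (dividedDifference i f)) =
    f - swapVars i f - swapVars (i + 1) f + swapVars i (swapVars (i + 1) f) +
      swapVars (i + 1) (swapVars i f) - swapVars i (swapVars (i + 1) (swapVars i f)) := by
  set g := dividedDifference i f with hg
  set h := dividedDifference (i + 1) g with hh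
  have e0 := swapVars_dividedDifference i f
  have e1 := mul_dividedDifference i f
  have e2 := mul_dividedDifference (i + 1) g
  have e3 := mul_dividedDifference i h
  rw [← hg] at e0 e1
  rw [← hh] at e2
  have e4 := congrArg (swapVars i) e2
  have e5 := congrArg (swapVars (i + 1)) e1
  have e6 := congrArg (swapVars i) e5
  have a1 : Equiv.swap i (i + 1) (i + 2) = i + 2 :=
    Equiv.swap_apply_of_ne_of_ne (by omega) (by omega)
  have a2 : Equiv.swap (i + 1) (i + 2) i = i := Equiv.swap_apply_of_ne_of_ne (by omega) (by omega)
  simp only [swapVars, map_mul, map_sub, rename_X, a1, a2, Equiv.swap_apply_left,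
    Equiv.swap_apply_right, add_assoc, one_add_one_eq_two] at e0 e1 e2 e3 e4 e5 e6 ⊢
  rw [e0] at e4
  linear_combination (X i - X (i + 2)) * (X (i + 1) - X (i + 2)) * e3 + (X i - X (i + 2)) * e2
    - (X (i + 1) - X (i + 2)) * e4 + e1 - e5 + e6

theorem vandermonde_mul_dividedDifference_right (i : ℕ) (f : MvPolynomial ℕ ℤ) :
    (X i - X (i + 1)) * (X i - X (i + 2)) * (X (i + 1) - X (i + 2)) *
      dividedDifference (i + 1) (dividedDifference i (dividedDifference (i + 1) f)) =
    f - swapVars i f - swapVars (i + 1) f + swapVars i (swapVars (i + 1) f) +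
      swapVars (i + 1) (swapVars i f) -
        swapVars (i + 1) (swapVars i (swapVars (i + 1) f)) := by
  set g := dividedDifference (i + 1) f with hg
  set h := dividedDifference i g with hh
  have e0 := swapVars_dividedDifference (i + 1) f
  have e1 := mul_dividedDifference (i + 1) f
  have e2 := mul_dividedDifference i g
  have e3 := mul_dividedDifference (i + 1) h
  rw [← hg] at e0 e1
  rw [← hh] at e2
  have e4 := congrArg (swapVars (i + 1)) e2
  have e5 := congrArg (swapVars i) e1
  have e6 := congrArg (swapVars (i + 1)) e5
  have a1 : Equiv.swap i (i + 1) (i + 2) = i + 2 :=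
    Equiv.swap_apply_of_ne_of_ne (by omega) (by omega)
  have a2 : Equiv.swap (i + 1) (i + 2) i = i := Equiv.swap_apply_of_ne_of_ne (by omega) (by omega)
  simp only [swapVars, map_mul, map_sub, rename_X, a1, a2, Equiv.swap_apply_left,
    Equiv.swap_apply_right, add_assoc, one_add_one_eq_two] at e0 e1 e2 e3 e4 e5 e6 ⊢
  rw [e0] at e4
  linear_combination (X i - X (i + 2)) * (X i - X (i + 1)) * e3 + (X i - X (i + 2)) * e2
    - (X i - X (i + 1)) * e4 + e1 - e5 + e6

theorem dividedDifference_braid (i : ℕ) (f : MvPolynomial ℕ ℤ) :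
    dividedDifference i (dividedDifference (i + 1) (dividedDifference i f)) =
      dividedDifference (i + 1) (dividedDifference i (dividedDifference (i + 1) f)) := by
  have h02 : (X i - X (i + 2) : MvPolynomial ℕ ℤ) ≠ 0 := by
    rw [sub_ne_zero]
    intro h
    have := X_injective h
    omega
  apply mul_left_cancel₀
    (mul_ne_zero (mul_ne_zero (X_sub_X_succ_ne_zero i) h02) (X_sub_X_succ_ne_zero (i + 1)))
  have h1 := vandermonde_mul_dividedDifference_left i f
  have h2 := vandermonde_mul_dividedDifference_right i f
  rw [swapVars_braid] at h1
  exact h1.trans h2.symm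

/-- A polynomial killed by all divided differences is symmetric in infinitely many variables,
hence constant. -/
theorem eq_C_of_dividedDifference_eq_zero {f : MvPolynomial ℕ ℤ}
    (hf : ∀ i, dividedDifference i f = 0) : f = C (constantCoeff f) := by
  have hdeg : ∀ i, degreeOf (i + 1) f = degreeOf i f := by
    intro i
    have h := (dividedDifference_eq_zero_iff i f).mp (hf i)
    conv_lhs => rw [← h]
    have := degreeOf_rename_of_injective (p := f) (Equiv.swap i (i + 1)).injective i
    rwa [Equiv.swap_apply_left] at this
  have hconst : ∀ i, degreeOf i f = degreeOf 0 f := by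
    intro i
    induction i with
    | zero => rfl
    | succ i ih => rw [hdeg, ih]
  obtain ⟨k, hk⟩ := Infinite.exists_notMem_finset f.vars
  have hzero : ∀ i, degreeOf i f = 0 := by
    intro i
    rw [hconst i, ← hconst k]
    refine Nat.le_zero.mp (degreeOf_le_iff.mpr fun m hm => ?_)
    by_contra hne
    exact hk ((mem_vars_iff_mem_support k).mpr ⟨m, hm, Finsupp.mem_support_iff.mpr (by omega)⟩)
  ext m
  by_cases hm : m = 0
  · rw [hm, coeff_C, if_pos rfl, constantCoeff_eq]
  · rw [coeff_C, if_neg (Ne.symm hm)]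
    by_contra hc
    apply hm
    ext i
    exact Nat.le_zero.mp (degreeOf_le_iff.mp (hzero i).le m (mem_support_iff.mpr hc))

/-- A polynomial is determined by its divided differences and its constant term. -/
theorem eq_of_dividedDifference_eq {f g : MvPolynomial ℕ ℤ}
    (h : ∀ i, dividedDifference i f = dividedDifference i g)
    (h0 : constantCoeff f = constantCoeff g) : f = g := by
  have := eq_C_of_dividedDifference_eq_zero (f := f - g) fun i => by
    rw [dividedDifference_sub, h, sub_self]
  rw [map_sub, h0, sub_self, map_zero] at this
  exact sub_eq_zero.mp this

theorem homogeneousComponent_succ_linear_mul {L : MvPolynomial ℕ ℤ} (hL : L.IsHomogeneous 1)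
    (g : MvPolynomial ℕ ℤ) (k : ℕ) :
    homogeneousComponent (k + 1) (L * g) = L * homogeneousComponent k g := by
  conv_lhs => rw [← sum_homogeneousComponent g, Finset.mul_sum, map_sum]
  have h : ∀ j, homogeneousComponent (k + 1) (L * homogeneousComponent j g) =
      if k = j then L * homogeneousComponent j g else 0 := by
    intro j
    have hj : (L * homogeneousComponent j g).IsHomogeneous (j + 1) := by
      rw [add_comm]; exact hL.mul (homogeneousComponent_isHomogeneous j g)
    rw [homogeneousComponent_of_mem ((mem_homogeneousSubmodule _ _).mpr hj)]
    simp
  simp only [h, Finset.sum_ite_eq, Finset.mem_range]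
  split_ifs with hk
  · rfl
  · rw [homogeneousComponent_eq_zero _ _ (by omega), mul_zero]

theorem isHomogeneous_dividedDifference {i d : ℕ} {f : MvPolynomial ℕ ℤ}
    (hf : f.IsHomogeneous d) : (dividedDifference i f).IsHomogeneous (d - 1) := by
  have hL : (X i - X (i + 1) : MvPolynomial ℕ ℤ).IsHomogeneous 1 :=
    (isHomogeneous_X ℤ i).sub (isHomogeneous_X ℤ (i + 1))
  have hfs : (f - swapVars i f).IsHomogeneous d := hf.sub hf.rename_isHomogeneous
  have hzero : ∀ k, k + 1 ≠ d → homogeneousComponent k (dividedDifference i f) = 0 := by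
    intro k hk
    have h := homogeneousComponent_succ_linear_mul hL (dividedDifference i f) k
    rw [mul_dividedDifference,
      homogeneousComponent_of_mem ((mem_homogeneousSubmodule _ _).mpr hfs), if_neg hk] at h
    exact (mul_eq_zero.mp h.symm).resolve_left (X_sub_X_succ_ne_zero i)
  rw [← sum_homogeneousComponent (dividedDifference i f)]
  refine IsHomogeneous.sum _ _ _ fun k _ => ?_
  by_cases hk : k + 1 = d
  · rw [← hk]; exact homogeneousComponent_isHomogeneous _ _
  · rw [hzero k hk]; exact isHomogeneous_zero _ _ _

/-! ### Permutations as functions on `ℕ` -/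

/-- The one-line notation of `w` as a function on `ℕ`, extended by the identity beyond `n`. -/
def entry {n : ℕ} (w : Equiv.Perm (Fin n)) (k : ℕ) : ℕ :=
  if h : k < n then w ⟨k, h⟩ else k

/-- The permutation `w sᵢ`: swap the entries in the positions `i` and `i + 1`. It is `w` itself if
these are not both positions of `w`. -/
def swapAt {n : ℕ} (w : Equiv.Perm (Fin n)) (i : ℕ) : Equiv.Perm (Fin n) :=
  if h : i + 1 < n then w * Equiv.swap ⟨i, Nat.lt_of_succ_lt h⟩ ⟨i + 1, h⟩ else w

section entry

variable {n : ℕ}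

theorem entry_of_lt (w : Equiv.Perm (Fin n)) {k : ℕ} (h : k < n) : entry w k = w ⟨k, h⟩ :=
  dif_pos h

theorem entry_of_le (w : Equiv.Perm (Fin n)) {k : ℕ} (h : n ≤ k) : entry w k = k :=
  dif_neg (by omega)

theorem entry_val (w : Equiv.Perm (Fin n)) (k : Fin n) : entry w k = w k :=
  entry_of_lt w k.2

theorem entry_lt (w : Equiv.Perm (Fin n)) {k : ℕ} (h : k < n) : entry w k < n := by
  rw [entry_of_lt w h]; exact (w ⟨k, h⟩).2

theorem entry_injective (w : Equiv.Perm (Fin n)) : Function.Injective (entry w) := by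
  intro a b hab
  rcases lt_or_ge a n with ha | ha <;> rcases lt_or_ge b n with hb | hb
  · rw [entry_of_lt w ha, entry_of_lt w hb] at hab
    exact congrArg Fin.val (w.injective (Fin.ext hab))
  · have := entry_lt w ha
    rw [entry_of_le w hb] at hab
    omega
  · have := entry_lt w hb
    rw [entry_of_le w ha] at hab
    omega
  · rwa [entry_of_le w ha, entry_of_le w hb] at hab

theorem exists_entry_eq (w : Equiv.Perm (Fin n)) {x : ℕ} (h : x < n) :
    ∃ k < n, entry w k = x :=
  ⟨w.symm ⟨x, h⟩, (w.symm ⟨x, h⟩).2, by rw [entry_val]; simp⟩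

theorem eq_of_entry_eq {w v : Equiv.Perm (Fin n)} (h : ∀ k < n, entry w k = entry v k) :
    w = v := by
  ext k
  rw [← entry_val, ← entry_val]
  exact h k k.2

theorem entry_one (k : ℕ) : entry (1 : Equiv.Perm (Fin n)) k = k := by
  unfold entry; split_ifs <;> rfl

theorem entry_swapAt (w : Equiv.Perm (Fin n)) {i : ℕ} (hi : i + 1 < n) (k : ℕ) :
    entry (swapAt w i) k = entry w (Equiv.swap i (i + 1) k) := by
  rcases eq_or_ne k i with rfl | h1
  · rw [Equiv.swap_apply_left, entry_of_lt _ (by omega), entry_of_lt _ hi]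
    simp [swapAt, hi]
  rcases eq_or_ne k (i + 1) with rfl | h2
  · rw [Equiv.swap_apply_right, entry_of_lt _ hi, entry_of_lt _ (Nat.lt_of_succ_lt hi)]
    simp [swapAt, hi]
  rw [Equiv.swap_apply_of_ne_of_ne h1 h2]
  rcases lt_or_ge k n with h | h
  · rw [entry_of_lt _ h, entry_of_lt _ h]
    simp only [swapAt, hi, dif_pos, Equiv.Perm.mul_apply]
    rw [Equiv.swap_apply_of_ne_of_ne] <;> simp [Fin.ext_iff, h1, h2]
  · rw [entry_of_le _ h, entry_of_le _ h]

theorem entry_swapAt_left (w : Equiv.Perm (Fin n)) {i : ℕ} (hi : i + 1 < n) :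
    entry (swapAt w i) i = entry w (i + 1) := by
  rw [entry_swapAt w hi, Equiv.swap_apply_left]

theorem entry_swapAt_right (w : Equiv.Perm (Fin n)) {i : ℕ} (hi : i + 1 < n) :
    entry (swapAt w i) (i + 1) = entry w i := by
  rw [entry_swapAt w hi, Equiv.swap_apply_right]

theorem entry_swapAt_of_ne (w : Equiv.Perm (Fin n)) {i k : ℕ} (h1 : k ≠ i)
    (h2 : k ≠ i + 1) : entry (swapAt w i) k = entry w k := by
  by_cases hi : i + 1 < n
  · rw [entry_swapAt w hi, Equiv.swap_apply_of_ne_of_ne h1 h2]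
  · rw [swapAt, dif_neg hi]

theorem swapAt_swapAt (w : Equiv.Perm (Fin n)) (i : ℕ) : swapAt (swapAt w i) i = w := by
  by_cases hi : i + 1 < n
  · apply eq_of_entry_eq
    intro k _
    rw [entry_swapAt _ hi, entry_swapAt _ hi, Equiv.swap_apply_self]
  · simp [swapAt, hi]

theorem swapAt_comm (w : Equiv.Perm (Fin n)) {i j : ℕ} (hij : i + 1 < j) (hj : j + 1 < n) :
    swapAt (swapAt w i) j = swapAt (swapAt w j) i := by
  apply eq_of_entry_eq
  intro k _
  rw [entry_swapAt _ hj, entry_swapAt _ (by omega), entry_swapAt _ (by omega), entry_swapAt _ hj]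
  congr 1
  simp only [Equiv.swap_apply_def]
  split_ifs <;> omega

theorem swapAt_braid (w : Equiv.Perm (Fin n)) {i : ℕ} (hi : i + 1 + 1 < n) :
    swapAt (swapAt (swapAt w i) (i + 1)) i = swapAt (swapAt (swapAt w (i + 1)) i) (i + 1) := by
  apply eq_of_entry_eq
  intro k _
  rw [entry_swapAt _ (by omega), entry_swapAt _ hi, entry_swapAt _ (by omega),
    entry_swapAt _ hi, entry_swapAt _ (by omega), entry_swapAt _ hi]
  congr 1
  simp only [Equiv.swap_apply_def]
  split_ifs <;> omega

/-- A descent of the extended one-line notation is a descent of the permutation. -/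
theorem succ_lt_of_descent {w : Equiv.Perm (Fin n)} {i : ℕ} (h : entry w (i + 1) < entry w i) :
    i + 1 < n := by
  by_contra hn
  rw [entry_of_le w (by omega : n ≤ i + 1)] at h
  rcases lt_or_ge i n with hi | hi
  · have := entry_lt w hi
    omega
  · rw [entry_of_le w hi] at h
    omega

theorem isAscent_iff (w : Equiv.Perm (Fin n)) (i : ℕ) :
    IsAscent w i ↔ i + 1 < n ∧ entry w i < entry w (i + 1) := by
  constructor
  · rintro ⟨hi, h⟩
    refine ⟨hi, ?_⟩
    rwa [entry_of_lt w hi, entry_of_lt w (Nat.lt_of_succ_lt hi)]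
  · rintro ⟨hi, h⟩
    refine ⟨hi, ?_⟩
    rwa [entry_of_lt w hi, entry_of_lt w (Nat.lt_of_succ_lt hi)] at h

theorem entry_lt_or_gt (w : Equiv.Perm (Fin n)) (i : ℕ) :
    entry w i < entry w (i + 1) ∨ entry w (i + 1) < entry w i :=
  lt_or_gt_of_ne fun h => by
    have := entry_injective w h
    omega

/-- Swapping the entries of an ascent lowers `∑ i, i * w i`. -/
theorem sum_mul_swapAt_lt (w : Equiv.Perm (Fin n)) {i : ℕ} (hi : i + 1 < n)
    (h : entry w i < entry w (i + 1)) :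
    ∑ k : Fin n, (k : ℕ) * (swapAt w i k : ℕ) < ∑ k : Fin n, (k : ℕ) * (w k : ℕ) := by
  rw [swapAt, dif_pos hi]
  apply sum_mul_swap_lt w _ _ (Fin.mk_lt_mk.mpr (Nat.lt_succ_self _))
  rwa [entry_of_lt w hi, entry_of_lt w (Nat.lt_of_succ_lt hi)] at h

/-- Induction on the length: to prove a property of `w`, assume it for all `w sᵢ` that are shorter
than `w`. -/
theorem descent_induction {motive : Equiv.Perm (Fin n) → Prop}
    (step : ∀ w, (∀ i, entry w (i + 1) < entry w i → motive (swapAt w i)) → motive w)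
    (w : Equiv.Perm (Fin n)) : motive w := by
  have hwf : WellFounded fun u v : Equiv.Perm (Fin n) =>
      ∑ k : Fin n, (k : ℕ) * (v k : ℕ) < ∑ k : Fin n, (k : ℕ) * (u k : ℕ) := by
    have : IsTrans (Equiv.Perm (Fin n)) fun u v =>
      ∑ k : Fin n, (k : ℕ) * (v k : ℕ) < ∑ k : Fin n, (k : ℕ) * (u k : ℕ) :=
      ⟨fun _ _ _ h1 h2 => h2.trans h1⟩
    have : Std.Irrefl fun u v : Equiv.Perm (Fin n) =>
      ∑ k : Fin n, (k : ℕ) * (v k : ℕ) < ∑ k : Fin n, (k : ℕ) * (u k : ℕ) :=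
      ⟨fun _ h => lt_irrefl _ h⟩
    exact Finite.wellFounded_of_trans_of_irrefl _
  induction w using hwf.induction with
  | h w ih =>
    refine step w fun i hi => ih _ ?_
    have hin := succ_lt_of_descent hi
    have := sum_mul_swapAt_lt (swapAt w i) hin
      (by rwa [entry_swapAt_left _ hin, entry_swapAt_right _ hin])
    rwa [swapAt_swapAt] at this

end entry

/-! ### Divided differences of Schubert polynomials -/

section recursion

variable {n : ℕ}

theorem schubert_revPerm : schubert (Fin.revPerm : Equiv.Perm (Fin n)) =
    monomial (staircase n) 1 := by
  rw [schubert, dif_pos rfl]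

/-- The recursion that defines Schubert polynomials, along first ascents. -/
theorem exists_firstAscent {w : Equiv.Perm (Fin n)} (hw : w ≠ Fin.revPerm) :
    ∃ i, i + 1 < n ∧ entry w i < entry w (i + 1) ∧
      (∀ j < i, entry w (j + 1) < entry w j) ∧
      schubert w = dividedDifference i (schubert (swapAt w i)) := by
  have h := exists_isAscent hw
  obtain ⟨h1, h2⟩ := (isAscent_iff w _).mp (Nat.find_spec h)
  refine ⟨Nat.find h, h1, h2, fun j hj => ?_, ?_⟩
  · have := Nat.find_min h hj
    rw [isAscent_iff, not_and] at this
    exact (entry_lt_or_gt w j).resolve_left (this (by omega))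
  · rw [swapAt, dif_pos h1]
    conv_lhs => rw [schubert, dif_neg hw]

/-- Induction along the recursion that defines Schubert polynomials. -/
theorem firstAscent_induction {motive : Equiv.Perm (Fin n) → Prop}
    (rev : motive Fin.revPerm)
    (step : ∀ w i, i + 1 < n → entry w i < entry w (i + 1) →
      (∀ j < i, entry w (j + 1) < entry w j) →
      schubert w = dividedDifference i (schubert (swapAt w i)) →
      motive (swapAt w i) → motive w)
    (w : Equiv.Perm (Fin n)) : motive w := by
  induction hm : ∑ k : Fin n, (k : ℕ) * (w k : ℕ) using Nat.strong_induction_on generalizing w with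
  | _ m ih =>
    by_cases hw : w = Fin.revPerm
    · rw [hw]; exact rev
    obtain ⟨i, h1, h2, h3, h4⟩ := exists_firstAscent hw
    exact step w i h1 h2 h3 h4 (ih _ (hm ▸ sum_mul_swapAt_lt w h1 h2) _ rfl)

/-- The recursion holds for all ascents, not only for the first one. -/
theorem schubert_eq_dividedDifference (w : Equiv.Perm (Fin n)) {i : ℕ} (hi : i + 1 < n)
    (h : entry w i < entry w (i + 1)) :
    schubert w = dividedDifference i (schubert (swapAt w i)) := by
  induction hm : ∑ k : Fin n, (k : ℕ) * (w k : ℕ) using Nat.strong_induction_on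
    generalizing w i with
  | _ m ih =>
    have IH : ∀ u : Equiv.Perm (Fin n),
        ∑ k : Fin n, (k : ℕ) * (u k : ℕ) < ∑ k : Fin n, (k : ℕ) * (w k : ℕ) →
        ∀ j, j + 1 < n → entry u j < entry u (j + 1) →
          schubert u = dividedDifference j (schubert (swapAt u j)) :=
      fun u hu j hj hlt => ih _ (hm ▸ hu) u hj hlt rfl
    have key : ∀ a b, a < b → b + 1 < n → entry w a < entry w (a + 1) →
        entry w b < entry w (b + 1) →
        dividedDifference a (schubert (swapAt w a)) =
          dividedDifference b (schubert (swapAt w b)) := by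
      intro a b hab hb ha1 hb1
      have la := sum_mul_swapAt_lt w (by omega : a + 1 < n) ha1
      have lb := sum_mul_swapAt_lt w hb hb1
      rcases lt_or_eq_of_le (Nat.succ_le_of_lt hab) with hlt | heq
      · have hlt : a + 1 < b := hlt
        rw [IH _ la b hb (by
            rw [entry_swapAt_of_ne _ (by omega) (by omega),
              entry_swapAt_of_ne _ (by omega) (by omega)]; exact hb1),
          IH _ lb a (by omega) (by
            rw [entry_swapAt_of_ne _ (by omega) (by omega),
              entry_swapAt_of_ne _ (by omega) (by omega)]; exact ha1),
          dividedDifference_comm hlt, swapAt_comm w hlt hb]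
      · have heq : b = a + 1 := heq.symm
        subst heq
        have ha : a + 1 < n := by omega
        have e1 : entry (swapAt w a) (a + 1) < entry (swapAt w a) (a + 1 + 1) := by
          rw [entry_swapAt_right _ ha, entry_swapAt_of_ne _ (by omega) (by omega)]
          omega
        have e2 : entry (swapAt (swapAt w a) (a + 1)) a <
            entry (swapAt (swapAt w a) (a + 1)) (a + 1) := by
          rw [entry_swapAt_left _ hb, entry_swapAt_of_ne _ (by omega) (by omega),
            entry_swapAt_left _ ha, entry_swapAt_of_ne _ (by omega) (by omega)]
          exact hb1
        have e3 : entry (swapAt w (a + 1)) a < entry (swapAt w (a + 1)) (a + 1) := by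
          rw [entry_swapAt_left _ hb, entry_swapAt_of_ne _ (by omega) (by omega)]
          omega
        have e4 : entry (swapAt (swapAt w (a + 1)) a) (a + 1) <
            entry (swapAt (swapAt w (a + 1)) a) (a + 1 + 1) := by
          rw [entry_swapAt_right _ ha, entry_swapAt_of_ne _ (by omega) (by omega),
            entry_swapAt_of_ne _ (by omega) (by omega), entry_swapAt_right _ hb]
          exact ha1
        rw [IH _ la _ hb e1, IH _ ((sum_mul_swapAt_lt _ hb e1).trans la) _ ha e2,
          IH _ lb _ ha e3, IH _ ((sum_mul_swapAt_lt _ ha e3).trans lb) _ hb e4,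
          dividedDifference_braid, swapAt_braid w hb]
    have hw : w ≠ Fin.revPerm := by
      rintro rfl
      rw [entry_of_lt _ (Nat.lt_of_succ_lt hi), entry_of_lt _ hi] at h
      simp only [Fin.revPerm_apply, Fin.val_rev] at h
      omega
    obtain ⟨j, h1, h2, -, h4⟩ := exists_firstAscent hw
    rw [h4]
    rcases lt_trichotomy i j with hij | rfl | hij
    · exact (key i j hij h1 h h2).symm
    · rfl
    · exact key j i hij hi h2 h

theorem staircase_apply (n i : ℕ) : staircase n i = n - 1 - i := rfl

theorem degreeOf_dividedDifference_le {n i : ℕ} (hi : i + 1 < n) {f : MvPolynomial ℕ ℤ}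
    (hf : ∀ j, degreeOf j f ≤ n - 1 - j) (j : ℕ) :
    degreeOf j (dividedDifference i f) ≤ n - 1 - j := by
  by_cases h0 : dividedDifference i f = 0
  · rw [h0]; simp
  have hmul := congrArg (degreeOf j) (mul_dividedDifference i f)
  rw [degreeOf_mul_eq (X_sub_X_succ_ne_zero i) h0] at hmul
  have hsub := degreeOf_sub_le j f (swapVars i f)
  have hswap : ∀ k, degreeOf (Equiv.swap i (i + 1) k) (swapVars i f) = degreeOf k f := fun k =>
    degreeOf_rename_of_injective (Equiv.injective _) k
  have hj := hswap (Equiv.swap i (i + 1) j)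
  rw [Equiv.swap_apply_self] at hj
  have hlin : ∀ k, k = i ∨ k = i + 1 → 1 ≤ degreeOf k (X i - X (i + 1) : MvPolynomial ℕ ℤ) := by
    intro k hk
    have hc : coeff (Finsupp.single k 1) (X i - X (i + 1) : MvPolynomial ℕ ℤ) ≠ 0 := by
      rw [coeff_sub, coeff_X, coeff_X]
      rcases hk with rfl | rfl <;> simp [Finsupp.single_left_inj]
    have := degreeOf_le_iff.mp (le_refl (degreeOf k _)) _ (mem_support_iff.mpr hc)
    simpa using this
  have f1 := hf i
  have f2 := hf (i + 1)
  have f3 := hf j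
  rcases eq_or_ne j i with rfl | h1
  · rw [Equiv.swap_apply_left] at hj
    have := hlin j (Or.inl rfl)
    omega
  rcases eq_or_ne j (i + 1) with rfl | h2
  · rw [Equiv.swap_apply_right] at hj
    have := hlin (i + 1) (Or.inr rfl)
    omega
  rw [Equiv.swap_apply_of_ne_of_ne h1 h2] at hj
  omega

theorem degreeOf_schubert_le (w : Equiv.Perm (Fin n)) (j : ℕ) :
    degreeOf j (schubert w) ≤ n - 1 - j := by
  induction w using firstAscent_induction generalizing j with
  | rev =>
    rw [schubert_revPerm, degreeOf_monomial_eq _ _ one_ne_zero, staircase_apply]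
  | step w i hi _ _ heq ih =>
    rw [heq]
    exact degreeOf_dividedDifference_le hi ih j

theorem le_staircase_of_coeff_schubert_ne_zero (w : Equiv.Perm (Fin n)) {m : ℕ →₀ ℕ}
    (hm : coeff m (schubert w) ≠ 0) : m ≤ staircase n := fun j =>
  degreeOf_le_iff.mp (degreeOf_schubert_le w j) m (mem_support_iff.mpr hm)

theorem notMem_vars_schubert (w : Equiv.Perm (Fin n)) {k : ℕ} (hk : n ≤ k + 1) :
    k ∉ (schubert w).vars := by
  intro hmem
  obtain ⟨m, hm, hkm⟩ := (mem_vars_iff_mem_support k).mp hmem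
  have := le_staircase_of_coeff_schubert_ne_zero w (mem_support_iff.mp hm) k
  rw [staircase_apply] at this
  exact Finsupp.mem_support_iff.mp hkm (by omega)

theorem dividedDifference_schubert_of_descent (w : Equiv.Perm (Fin n)) {i : ℕ}
    (h : entry w (i + 1) < entry w i) :
    dividedDifference i (schubert w) = schubert (swapAt w i) := by
  have hi := succ_lt_of_descent h
  rw [schubert_eq_dividedDifference (swapAt w i) hi, swapAt_swapAt]
  rwa [entry_swapAt_left _ hi, entry_swapAt_right _ hi]

theorem dividedDifference_schubert_of_ascent (w : Equiv.Perm (Fin n)) {i : ℕ}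
    (h : entry w i < entry w (i + 1)) : dividedDifference i (schubert w) = 0 := by
  rw [dividedDifference_eq_zero_iff]
  by_cases hi : i + 1 < n
  · rw [schubert_eq_dividedDifference w hi h, swapVars_dividedDifference]
  · have hz : ∀ k, n ≤ k + 1 → k ∉ (schubert w).vars := fun k => notMem_vars_schubert w
    have : rename (Equiv.swap i (i + 1)) (schubert w) = rename id (schubert w) := by
      refine hom_congr_vars (f₁ := (rename (Equiv.swap i (i + 1))).toRingHom)
        (f₂ := (rename id).toRingHom) (by ext; simp) (fun k hk _ => ?_) rfl
      have h1 : k ≠ i := fun h => hz k (by omega) hk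
      have h2 : k ≠ i + 1 := fun h => hz k (by omega) hk
      simp [Equiv.swap_apply_of_ne_of_ne h1 h2]
    rwa [rename_id_apply] at this

end recursion

/-! ### Permutations that avoid 132 -/

section dominant

variable {n : ℕ}

theorem avoids132_iff (w : Equiv.Perm (Fin n)) :
    Avoids132 w ↔ ¬ ∃ i j k, i < j ∧ j < k ∧ entry w i < entry w k ∧ entry w k < entry w j := by
  refine not_congr ⟨?_, ?_⟩
  · rintro ⟨i, j, k, h1, h2, h3, h4⟩
    refine ⟨i, j, k, h1, h2, ?_, ?_⟩ <;> rw [entry_val, entry_val] <;> assumption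
  · rintro ⟨i, j, k, h1, h2, h3, h4⟩
    have hk : k < n := by
      by_contra hk
      rw [entry_of_le w (by omega : n ≤ k)] at h4
      rcases lt_or_ge j n with hj | hj
      · have := entry_lt w hj
        omega
      · rw [entry_of_le w hj] at h4
        omega
    rw [entry_of_lt w hk] at h3 h4
    rw [entry_of_lt w (h2.trans hk)] at h4
    rw [entry_of_lt w (h1.trans (h2.trans hk))] at h3
    exact ⟨⟨i, _⟩, ⟨j, _⟩, ⟨k, _⟩, h1, h2, h3, h4⟩

theorem avoids312_iff (w : Equiv.Perm (Fin n)) :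
    Avoids312 w ↔ ¬ ∃ i j k, i < j ∧ j < k ∧ entry w j < entry w k ∧ entry w k < entry w i := by
  refine not_congr ⟨?_, ?_⟩
  · rintro ⟨i, j, k, h1, h2, h3, h4⟩
    refine ⟨i, j, k, h1, h2, ?_, ?_⟩ <;> rw [entry_val, entry_val] <;> assumption
  · rintro ⟨i, j, k, h1, h2, h3, h4⟩
    have hk : k < n := by
      by_contra hk
      rw [entry_of_le w (by omega : n ≤ k)] at h4
      rcases lt_or_ge i n with hi | hi
      · have := entry_lt w hi
        omega
      · rw [entry_of_le w hi] at h4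
        omega
    rw [entry_of_lt w hk] at h3 h4
    rw [entry_of_lt w (h1.trans (h2.trans hk))] at h4
    rw [entry_of_lt w (h2.trans hk)] at h3
    exact ⟨⟨i, _⟩, ⟨j, _⟩, ⟨k, _⟩, h1, h2, h3, h4⟩

/-- The positions to the right of `i` that carry a smaller entry. -/
def smallerAfter (w : Equiv.Perm (Fin n)) (i : ℕ) : Finset ℕ :=
  (Finset.range n).filter fun j => i < j ∧ entry w j < entry w i

theorem mem_smallerAfter {w : Equiv.Perm (Fin n)} {i j : ℕ} :
    j ∈ smallerAfter w i ↔ j < n ∧ i < j ∧ entry w j < entry w i := by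
  simp [smallerAfter]

/-- The Lehmer code of `w`, as an exponent vector. -/
noncomputable def code (w : Equiv.Perm (Fin n)) : ℕ →₀ ℕ :=
  Finsupp.onFinset (Finset.range n) (fun i => (smallerAfter w i).card) fun i hi => by
    obtain ⟨j, hj⟩ := Finset.card_ne_zero.mp hi
    rw [mem_smallerAfter] at hj
    exact Finset.mem_range.mpr (by omega)

theorem code_apply (w : Equiv.Perm (Fin n)) (i : ℕ) : code w i = (smallerAfter w i).card := rfl

theorem code_revPerm : code (Fin.revPerm : Equiv.Perm (Fin n)) = staircase n := by
  have he : ∀ k, k < n → entry (Fin.revPerm : Equiv.Perm (Fin n)) k = n - (k + 1) := fun k hk => by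
    rw [entry_of_lt _ hk]; simp
  ext i
  rw [code_apply, staircase_apply]
  have : smallerAfter (Fin.revPerm : Equiv.Perm (Fin n)) i = Finset.Ioo i n := by
    ext j
    rw [mem_smallerAfter, Finset.mem_Ioo]
    constructor
    · omega
    · rintro ⟨h1, h2⟩
      rw [he _ h2, he _ (h1.trans h2)]
      omega
  rw [this, Nat.card_Ioo]
  omega

theorem code_one : code (1 : Equiv.Perm (Fin n)) = 0 := by
  ext i
  rw [code_apply, Finsupp.zero_apply, Finset.card_eq_zero, Finset.eq_empty_iff_forall_notMem]
  intro j hj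
  rw [mem_smallerAfter, entry_one, entry_one] at hj
  omega

theorem code_swapAt_left (w : Equiv.Perm (Fin n)) {i : ℕ} (hi : i + 1 < n)
    (h : entry w i < entry w (i + 1)) : code (swapAt w i) i = code w (i + 1) + 1 := by
  rw [code_apply, code_apply]
  have : smallerAfter (swapAt w i) i = insert (i + 1) (smallerAfter w (i + 1)) := by
    ext j
    rw [Finset.mem_insert, mem_smallerAfter, mem_smallerAfter, entry_swapAt_left w hi]
    rcases eq_or_ne j (i + 1) with rfl | hj
    · rw [entry_swapAt_right w hi]
      simp [hi, h]
    · constructor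
      · rintro ⟨h1, h2, h3⟩
        rw [entry_swapAt_of_ne w (by omega) hj] at h3
        exact Or.inr ⟨h1, by omega, h3⟩
      · rintro (h1 | ⟨h1, h2, h3⟩)
        · exact absurd h1 hj
        · rw [entry_swapAt_of_ne w (by omega) hj]
          exact ⟨h1, by omega, h3⟩
  rw [this, Finset.card_insert_of_notMem]
  rw [mem_smallerAfter]
  omega

theorem code_swapAt_right (w : Equiv.Perm (Fin n)) {i : ℕ} (hi : i + 1 < n)
    (h : entry w i < entry w (i + 1)) : code (swapAt w i) (i + 1) = code w i := by
  rw [code_apply, code_apply]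
  congr 1
  ext j
  rw [mem_smallerAfter, mem_smallerAfter, entry_swapAt_right w hi]
  constructor
  · rintro ⟨h1, h2, h3⟩
    rw [entry_swapAt_of_ne w (by omega) (by omega)] at h3
    exact ⟨h1, by omega, h3⟩
  · rintro ⟨h1, h2, h3⟩
    have hj : j ≠ i + 1 := by rintro rfl; omega
    rw [entry_swapAt_of_ne w (by omega) hj]
    exact ⟨h1, by omega, h3⟩

theorem code_swapAt_of_ne (w : Equiv.Perm (Fin n)) {i k : ℕ} (hi : i + 1 < n)
    (h1 : k ≠ i) (h2 : k ≠ i + 1) : code (swapAt w i) k = code w k := by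
  rw [code_apply, code_apply]
  apply Finset.card_equiv (Equiv.swap i (i + 1))
  intro j
  rw [mem_smallerAfter, mem_smallerAfter, entry_swapAt_of_ne w h1 h2, entry_swapAt w hi]
  refine and_congr ?_ (and_congr_left' ?_)
  · rw [Equiv.swap_apply_def]; split_ifs <;> omega
  · rw [Equiv.swap_apply_def]; split_ifs <;> omega

theorem dividedDifference_monomial_add_single {i : ℕ} {m : ℕ →₀ ℕ} (h : m i = m (i + 1)) :
    dividedDifference i (monomial (m + Finsupp.single i 1) 1) = monomial m 1 := by
  have hs : swapVars i (monomial m 1) = monomial m 1 := by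
    rw [swapVars, rename_monomial]
    refine congrArg (fun m => monomial m (1 : ℤ)) (Finsupp.ext fun k => ?_)
    rw [Finsupp.mapDomain_equiv_apply, Equiv.symm_swap, Equiv.swap_apply_def]
    split_ifs with h1 h2
    · rw [h1, h]
    · rw [h2, h]
    · rfl
  have hmul : (monomial (m + Finsupp.single i 1) 1 : MvPolynomial ℕ ℤ) = monomial m 1 * X i := by
    rw [X, monomial_mul, one_mul]
  apply dividedDifference_eq_of_mul_eq
  rw [hmul]
  have : swapVars i (monomial m 1 * X i) = monomial m 1 * X (i + 1) := by
    conv_rhs => rw [← hs]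
    simp [swapVars]
  rw [this]
  ring

/-- The Schubert polynomial of a permutation that avoids 132 is a single monomial. -/
theorem schubert_eq_monomial_of_avoids132 (w : Equiv.Perm (Fin n)) (hw : Avoids132 w) :
    schubert w = monomial (code w) 1 := by
  induction w using firstAscent_induction with
  | rev => rw [schubert_revPerm, code_revPerm]
  | step w i hi hasc hdesc heq ih =>
    rw [avoids132_iff] at hw
    have hanti : ∀ p < i, entry w i < entry w p := by
      intro p hp
      have : ∀ d, p + d + 1 ≤ i → entry w (p + d + 1) < entry w p := by
        intro d
        induction d with
        | zero => intro hd; exact hdesc p (by omega)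
        | succ d ihd =>
          intro hd
          exact (hdesc (p + d + 1) (by omega)).trans (ihd (by omega))
      have := this (i - p - 1) (by omega)
      rwa [show p + (i - p - 1) + 1 = i by omega] at this
    -- Before the first ascent the entries decrease, so the swapped pair cannot be the `32` of a
    -- pattern `132`.
    have hav : Avoids132 (swapAt w i) := by
      rw [avoids132_iff]
      rintro ⟨p, q, r, h1, h2, h3, h4⟩
      apply hw
      have hpq : ¬ (p = i ∧ q = i + 1) := by
        rintro ⟨rfl, rfl⟩
        rw [entry_swapAt_left _ hi] at h3
        rw [entry_swapAt_right _ hi] at h4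
        omega
      have hqr : ¬ (q = i ∧ r = i + 1) := by
        rintro ⟨rfl, rfl⟩
        rw [entry_swapAt_right _ hi, entry_swapAt_of_ne _ (by omega) (by omega)] at h3
        have := hanti p h1
        omega
      have hmono : ∀ a b, a < b → ¬ (a = i ∧ b = i + 1) →
          Equiv.swap i (i + 1) a < Equiv.swap i (i + 1) b := by
        intro a b hab hne
        simp only [Equiv.swap_apply_def]
        split_ifs <;> omega
      rw [entry_swapAt _ hi, entry_swapAt _ hi] at h3 h4
      exact ⟨_, _, _, hmono p q h1 hpq, hmono q r h2 hqr, h3, h4⟩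
    have hcode : code w i = code w (i + 1) := by
      rw [code_apply, code_apply]
      congr 1
      ext j
      rw [mem_smallerAfter, mem_smallerAfter]
      constructor
      · rintro ⟨h1, h2, h3⟩
        have : j ≠ i + 1 := by rintro rfl; omega
        exact ⟨h1, by omega, by omega⟩
      · rintro ⟨h1, h2, h3⟩
        refine ⟨h1, by omega, ?_⟩
        by_contra hlt
        have : entry w i ≠ entry w j := fun h => by
          have := entry_injective w h
          omega
        exact hw ⟨i, i + 1, j, by omega, h2, by omega, h3⟩
    have hsw : code (swapAt w i) = code w + Finsupp.single i 1 := by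
      ext k
      rw [Finsupp.add_apply, Finsupp.single_apply]
      rcases eq_or_ne k i with rfl | h1
      · rw [code_swapAt_left w hi hasc, if_pos rfl, hcode]
      rcases eq_or_ne k (i + 1) with rfl | h2
      · rw [code_swapAt_right w hi hasc, if_neg (by omega), hcode]; rfl
      · rw [code_swapAt_of_ne w hi h1 h2, if_neg h1.symm]; rfl
    rw [heq, ih hav, hsw, dividedDifference_monomial_add_single hcode]

theorem schubert_one : schubert (1 : Equiv.Perm (Fin n)) = 1 := by
  rw [schubert_eq_monomial_of_avoids132, code_one]
  · rfl
  · rw [avoids132_iff]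
    rintro ⟨i, j, k, h1, h2, h3, h4⟩
    rw [entry_one, entry_one] at h4
    omega

theorem eq_one_of_forall_ascent {w : Equiv.Perm (Fin n)}
    (h : ∀ i, entry w i < entry w (i + 1)) : w = 1 := by
  have hmono : StrictMono (entry w) := strictMono_nat_of_lt_succ h
  apply eq_of_entry_eq
  intro k hk
  rw [entry_one]
  apply le_antisymm _ (hmono.le_apply)
  have : ∀ d, entry w k + d ≤ entry w (k + d) := by
    intro d
    induction d with
    | zero => simp
    | succ d ih =>
      have := h (k + d)
      change entry w k + d + 1 ≤ entry w (k + d + 1)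
      omega
  have := this (n - k)
  rw [entry_of_le w (by omega : n ≤ k + (n - k))] at this
  omega

theorem schubert_ne_zero (w : Equiv.Perm (Fin n)) : schubert w ≠ 0 := by
  induction w using descent_induction with
  | step w ih =>
    by_cases h : ∀ i, entry w i < entry w (i + 1)
    · rw [eq_one_of_forall_ascent h, schubert_one]
      exact one_ne_zero
    · push Not at h
      obtain ⟨i, hi⟩ := h
      have hi : entry w (i + 1) < entry w i := (entry_lt_or_gt w i).resolve_left (by omega)
      intro h0
      apply ih i hi
      rw [← dividedDifference_schubert_of_descent w hi, h0, dividedDifference_zero]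

theorem exists_isHomogeneous_schubert (w : Equiv.Perm (Fin n)) :
    ∃ d, (schubert w).IsHomogeneous d := by
  induction w using firstAscent_induction with
  | rev => exact ⟨_, schubert_revPerm (n := n) ▸ isHomogeneous_monomial _ rfl⟩
  | step w i _ _ _ heq ih =>
    obtain ⟨d, hd⟩ := ih
    exact ⟨_, heq ▸ isHomogeneous_dividedDifference hd⟩

theorem constantCoeff_schubert (w : Equiv.Perm (Fin n)) :
    constantCoeff (schubert w) = if w = 1 then 1 else 0 := by
  split_ifs with hw
  · rw [hw, schubert_one, map_one]
  by_contra h0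
  apply hw
  apply eq_one_of_forall_ascent
  intro i
  refine (entry_lt_or_gt w i).resolve_right fun hi => ?_
  obtain ⟨d, hd⟩ := exists_isHomogeneous_schubert w
  have hd0 : d = 0 := by
    by_contra hne
    exact h0 (hd.coeff_eq_zero (by simpa using Ne.symm hne))
  rw [hd0, ← totalDegree_zero_iff_isHomogeneous, totalDegree_eq_zero_iff_eq_C] at hd
  apply schubert_ne_zero (swapAt w i)
  rw [← dividedDifference_schubert_of_descent w hi, dividedDifference_eq_zero_iff, hd]
  simp [swapVars]

end dominant

/-! ### Complements of polynomials -/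

section complement

theorem algebraMap_monomial_mul_aeval_inv (m : ℕ →₀ ℕ) (a : ℤ) :
    algebraMap (MvPolynomial ℕ ℤ) RatField (monomial m 1) *
      aeval (fun i => (algebraMap (MvPolynomial ℕ ℤ) RatField (X i))⁻¹) (monomial m a) =
    algebraMap (MvPolynomial ℕ ℤ) RatField (C a) := by
  have hX : ∀ i, algebraMap (MvPolynomial ℕ ℤ) RatField (X i) ≠ 0 := fun i h =>
    X_ne_zero (R := ℤ) i ((IsFractionRing.injective (MvPolynomial ℕ ℤ) RatField)
      (h.trans (map_zero _).symm))
  rw [aeval_monomial, monomial_eq (a := (1 : ℤ)), C_1, one_mul, Finsupp.prod, Finsupp.prod, map_prod,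
    mul_left_comm, ← Finset.prod_mul_distrib, Finset.prod_eq_one, mul_one]
  · simp
  · intro i _
    rw [map_pow, inv_pow, mul_inv_cancel₀ (pow_ne_zero _ (hX i))]

theorem complement_monomial {μ m : ℕ →₀ ℕ} (h : m ≤ μ) (a : ℤ) :
    complement μ (monomial m a) =
      algebraMap (MvPolynomial ℕ ℤ) RatField (monomial (μ - m) a) := by
  have h1 : (monomial μ 1 : MvPolynomial ℕ ℤ) = monomial (μ - m) 1 * monomial m 1 := by
    rw [monomial_mul, one_mul, tsub_add_cancel_of_le h]
  rw [complement, h1, map_mul, mul_assoc, algebraMap_monomial_mul_aeval_inv, ← map_mul, mul_comm,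
    C_mul_monomial, mul_one]

/-- `f` and `g` are polynomials with exponents at most `μ`, and they are complements of each other
with respect to `μ`. -/
structure IsComplementPair (μ : ℕ →₀ ℕ) (f g : MvPolynomial ℕ ℤ) : Prop where
  le_left : ∀ m, coeff m f ≠ 0 → m ≤ μ
  le_right : ∀ m, coeff m g ≠ 0 → m ≤ μ
  coeff_eq : ∀ m m', m + m' = μ → coeff m f = coeff m' g

theorem IsComplementPair.symm {μ : ℕ →₀ ℕ} {f g : MvPolynomial ℕ ℤ} (h : IsComplementPair μ f g) :
    IsComplementPair μ g f :=
  ⟨h.le_right, h.le_left, fun m m' hm => (h.coeff_eq m' m (by rw [add_comm, hm])).symm⟩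

theorem IsComplementPair.of_complement_eq {μ : ℕ →₀ ℕ} {f g : MvPolynomial ℕ ℤ}
    (hf : ∀ m, coeff m f ≠ 0 → m ≤ μ)
    (h : complement μ f = algebraMap (MvPolynomial ℕ ℤ) RatField g) : IsComplementPair μ f g := by
  have hg : g = ∑ m ∈ f.support, monomial (μ - m) (coeff m f) := by
    apply IsFractionRing.injective (MvPolynomial ℕ ℤ) RatField
    rw [← h, map_sum]
    conv_lhs => rw [complement, as_sum f, map_sum, Finset.mul_sum]
    exact Finset.sum_congr rfl fun m hm => complement_monomial (hf m (mem_support_iff.mp hm)) _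
  refine ⟨hf, fun m hm => ?_, fun m m' hm => ?_⟩
  · rw [hg, coeff_sum] at hm
    obtain ⟨k, -, hk⟩ := Finset.exists_ne_zero_of_sum_ne_zero hm
    rw [coeff_monomial] at hk
    split_ifs at hk with he
    · rw [← he]; exact tsub_le_self
    · exact absurd rfl hk
  · rw [hg, coeff_sum]
    have hm' : μ - m = m' := by rw [← hm, add_tsub_cancel_left]
    rw [Finset.sum_eq_single m]
    · rw [coeff_monomial, if_pos hm']
    · intro k hk hne
      rw [coeff_monomial, if_neg]
      intro hk'
      apply hne
      have h1 := tsub_add_cancel_of_le (hf k (mem_support_iff.mp hk))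
      rw [hk', ← hm, add_comm] at h1
      exact add_right_cancel h1
    · intro hm0
      rw [notMem_support_iff.mp hm0, map_zero, coeff_zero]

variable {n : ℕ}

theorem entry_permComplement (w : Equiv.Perm (Fin n)) {k : ℕ} (hk : k < n) :
    entry (permComplement w) k = n - (entry w k + 1) := by
  rw [entry_of_lt _ hk, entry_of_lt _ hk]
  simp [permComplement]

theorem avoids132_permComplement {w : Equiv.Perm (Fin n)} (hw : Avoids312 w) :
    Avoids132 (permComplement w) := by
  rintro ⟨i, j, k, h1, h2, h3, h4⟩
  apply hw
  simp only [permComplement, Equiv.Perm.mul_apply, Fin.revPerm_apply, Fin.rev_lt_rev] at h3 h4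
  exact ⟨i, j, k, h1, h2, h4, h3⟩

theorem code_add_code_permComplement (w : Equiv.Perm (Fin n)) :
    code w + code (permComplement w) = staircase n := by
  ext i
  rw [Finsupp.add_apply, code_apply, code_apply, staircase_apply,
    ← Finset.card_union_of_disjoint]
  · have : smallerAfter w i ∪ smallerAfter (permComplement w) i = Finset.Ioo i n := by
      ext j
      rw [Finset.mem_union, mem_smallerAfter, mem_smallerAfter, Finset.mem_Ioo]
      constructor
      · omega
      · rintro ⟨h1, h2⟩
        have h3 : entry w i ≠ entry w j := fun h => h1.ne (entry_injective w h)
        have h4 := entry_lt w h2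
        have h5 := entry_lt w (h1.trans h2)
        rw [entry_permComplement w h2, entry_permComplement w (h1.trans h2)]
        omega
    rw [this, Nat.card_Ioo]
    omega
  · rw [Finset.disjoint_left]
    intro j h1 h2
    rw [mem_smallerAfter] at h1 h2
    rw [entry_permComplement w h1.1, entry_permComplement w (by omega)] at h2
    omega

theorem complement_schubert_of_avoids {w : Equiv.Perm (Fin n)} (h1 : Avoids132 w)
    (h2 : Avoids312 w) : complement (staircase n) (schubert w) =
      algebraMap (MvPolynomial ℕ ℤ) RatField (schubert (permComplement w)) := by
  have h := code_add_code_permComplement w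
  rw [schubert_eq_monomial_of_avoids132 w h1,
    schubert_eq_monomial_of_avoids132 _ (avoids132_permComplement h2),
    complement_monomial (h ▸ le_self_add), ← h, add_tsub_cancel_left]

end complement

/-! ### Expansion in powers of the first variable -/

section slice

/-- The exponent vector `(p, m₀, m₁, …)`. -/
noncomputable def consExponent (p : ℕ) (m : ℕ →₀ ℕ) : ℕ →₀ ℕ :=
  Finsupp.single 0 p + m.mapDomain Nat.succ

@[simp] theorem consExponent_zero (p : ℕ) (m : ℕ →₀ ℕ) : consExponent p m 0 = p := by
  rw [consExponent, Finsupp.add_apply, Finsupp.mapDomain_of_notMem_range]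
  · simp
  · simp

@[simp] theorem consExponent_succ (p : ℕ) (m : ℕ →₀ ℕ) (k : ℕ) :
    consExponent p m (k + 1) = m k := by
  rw [consExponent, Finsupp.add_apply, Finsupp.single_eq_of_ne (by omega), zero_add]
  exact Finsupp.mapDomain_apply Nat.succ_injective m k

theorem exists_eq_consExponent (s : ℕ →₀ ℕ) : ∃ p m, s = consExponent p m := by
  refine ⟨s 0, s.comapDomain Nat.succ Nat.succ_injective.injOn, ?_⟩
  ext k
  cases k <;> simp

theorem consExponent_inj {p q : ℕ} {m m' : ℕ →₀ ℕ} :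
    consExponent p m = consExponent q m' ↔ p = q ∧ m = m' := by
  refine ⟨fun h => ⟨?_, ?_⟩, fun h => by rw [h.1, h.2]⟩
  · simpa using DFunLike.congr_fun h 0
  · ext k
    simpa using DFunLike.congr_fun h (k + 1)

theorem consExponent_le {p q : ℕ} {m m' : ℕ →₀ ℕ} :
    consExponent p m ≤ consExponent q m' ↔ p ≤ q ∧ m ≤ m' := by
  refine ⟨fun h => ⟨by simpa using h 0, fun k => by simpa using h (k + 1)⟩, ?_⟩
  rintro ⟨h1, h2⟩ k
  cases k with
  | zero => simpa using h1
  | succ k => simpa using h2 k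

theorem consExponent_add (p q : ℕ) (m m' : ℕ →₀ ℕ) :
    consExponent p m + consExponent q m' = consExponent (p + q) (m + m') := by
  ext k
  cases k <;> simp

theorem staircase_succ (n : ℕ) : staircase (n + 1) = consExponent n (staircase n) := by
  ext k
  cases k <;> simp [staircase_apply]
  omega

/-- The isomorphism `ℤ[x₁, x₂, …] → ℤ[x₁, x₂, …][t]` that sends `x₁` to `t` and shifts the index of
all other variables by one. -/
noncomputable def splitFirst : MvPolynomial ℕ ℤ →ₐ[ℤ] Polynomial (MvPolynomial ℕ ℤ) :=
  aeval fun k => Nat.casesOn k Polynomial.X fun k => Polynomial.C (X k)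

theorem splitFirst_X_zero : splitFirst (X 0) = Polynomial.X := by
  simp [splitFirst]

theorem splitFirst_X_succ (k : ℕ) : splitFirst (X (k + 1)) = Polynomial.C (X k) := by
  simp [splitFirst]

/-- The coefficient of `x₁ᵖ` in `f`, a polynomial in `x₂, x₃, …` that is written in
`x₁, x₂, …`. -/
noncomputable def slice (p : ℕ) (f : MvPolynomial ℕ ℤ) : MvPolynomial ℕ ℤ :=
  (splitFirst f).coeff p

theorem splitFirst_rename_succ (f : MvPolynomial ℕ ℤ) :
    splitFirst (rename Nat.succ f) = Polynomial.C f := by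
  induction f using MvPolynomial.induction_on with
  | C a => simp [splitFirst]
  | add p q hp hq => rw [map_add, map_add, hp, hq, map_add]
  | mul_X p k hp => rw [map_mul, map_mul, hp, rename_X, splitFirst_X_succ, map_mul]

theorem coeff_slice (p : ℕ) (m : ℕ →₀ ℕ) (f : MvPolynomial ℕ ℤ) :
    coeff m (slice p f) = coeff (consExponent p m) f := by
  unfold slice
  induction f using MvPolynomial.induction_on' with
  | monomial s a =>
    obtain ⟨q, m', rfl⟩ := exists_eq_consExponent s
    have h : (monomial (consExponent q m') a : MvPolynomial ℕ ℤ) =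
        X 0 ^ q * rename Nat.succ (monomial m' a) := by
      rw [rename_monomial, X_pow_eq_monomial, monomial_mul, one_mul, consExponent]
    rw [coeff_monomial]
    simp only [consExponent_inj]
    rw [h, map_mul, map_pow, splitFirst_X_zero, splitFirst_rename_succ, mul_comm,
      Polynomial.coeff_C_mul_X_pow]
    by_cases hp : p = q
    · rw [if_pos hp, coeff_monomial]; simp [hp]
    · rw [if_neg hp, coeff_zero, if_neg (fun h => hp h.1.symm)]
  | add f g hf hg => rw [map_add, Polynomial.coeff_add, coeff_add, hf, hg, coeff_add]

theorem slice_swapVars (p i : ℕ) (f : MvPolynomial ℕ ℤ) :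
    slice p (swapVars (i + 1) f) = swapVars i (slice p f) := by
  have h : splitFirst (swapVars (i + 1) f) =
      (splitFirst f).map (rename (Equiv.swap i (i + 1))).toRingHom := by
    unfold swapVars
    induction f using MvPolynomial.induction_on with
    | C a => simp [splitFirst]
    | add p q hp hq => rw [map_add, map_add, hp, hq, map_add, Polynomial.map_add]
    | mul_X p k hp =>
      rw [map_mul, map_mul, hp, map_mul, Polynomial.map_mul, rename_X]
      congr 1
      cases k with
      | zero =>
        rw [Equiv.swap_apply_of_ne_of_ne (by omega) (by omega), splitFirst_X_zero,
          Polynomial.map_X]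
      | succ k =>
        have : Equiv.swap (i + 1) (i + 1 + 1) (k + 1) = Equiv.swap i (i + 1) k + 1 := by
          simp only [Equiv.swap_apply_def]
          split_ifs <;> omega
        rw [this, splitFirst_X_succ, splitFirst_X_succ, Polynomial.map_C]
        simp
  rw [slice, h, Polynomial.coeff_map]
  rfl

theorem dividedDifference_slice (p i : ℕ) (f : MvPolynomial ℕ ℤ) :
    dividedDifference i (slice p f) = slice p (dividedDifference (i + 1) f) := by
  apply dividedDifference_eq_of_mul_eq
  rw [← slice_swapVars]
  have h := congrArg (fun g => (splitFirst g).coeff p) (mul_dividedDifference (i + 1) f)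
  rw [map_mul, map_sub, map_sub, splitFirst_X_succ, splitFirst_X_succ, ← Polynomial.C_sub,
    Polynomial.coeff_C_mul, Polynomial.coeff_sub] at h
  exact h

@[simp] theorem slice_zero (p : ℕ) : slice p 0 = 0 := by
  simp [slice]

theorem IsComplementPair.slice {n p q : ℕ} {f g : MvPolynomial ℕ ℤ}
    (h : IsComplementPair (staircase (n + 1)) f g) (hpq : p + q = n) :
    IsComplementPair (staircase n) (slice p f) (slice q g) := by
  rw [staircase_succ] at h
  refine ⟨fun m hm => ?_, fun m hm => ?_, fun m m' hm => ?_⟩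
  · rw [coeff_slice] at hm
    exact (consExponent_le.mp (h.le_left _ hm)).2
  · rw [coeff_slice] at hm
    exact (consExponent_le.mp (h.le_right _ hm)).2
  · rw [coeff_slice, coeff_slice]
    exact h.coeff_eq _ _ (by rw [consExponent_add, hpq, hm])

theorem IsComplementPair.le_of_slice_ne_zero {n p : ℕ} {f g : MvPolynomial ℕ ℤ}
    (h : IsComplementPair (staircase (n + 1)) f g) (hp : SchubertComplement.slice p f ≠ 0) :
    p ≤ n := by
  obtain ⟨m, hm⟩ := ne_zero_iff.mp hp
  rw [coeff_slice] at hm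
  have := h.le_left _ hm
  rw [staircase_succ, consExponent_le] at this
  exact this.1

theorem IsComplementPair.right_ne_zero {μ : ℕ →₀ ℕ} {f g : MvPolynomial ℕ ℤ}
    (h : IsComplementPair μ f g) (hf : f ≠ 0) : g ≠ 0 := by
  obtain ⟨m, hm⟩ := ne_zero_iff.mp hf
  rw [h.coeff_eq m (μ - m) (add_tsub_cancel_of_le (h.le_left m hm))] at hm
  exact ne_zero_iff.mpr ⟨_, hm⟩

end slice

/-! ### Restriction to a coordinate axis -/

section axis

/-- Substitute `t` for the variable `X j` and `0` for all other variables. -/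
noncomputable def restrictAxis (j : ℕ) : MvPolynomial ℕ ℤ →ₐ[ℤ] Polynomial ℤ :=
  aeval fun k => if k = j then Polynomial.X else 0

theorem restrictAxis_swapVars (j : ℕ) (f : MvPolynomial ℕ ℤ) :
    restrictAxis j (swapVars j f) = restrictAxis (j + 1) f := by
  rw [swapVars, restrictAxis, aeval_rename, restrictAxis]
  congr 2
  ext k : 1
  simp only [Function.comp_apply, Equiv.swap_apply_def]
  split_ifs <;> first | rfl | omega

theorem X_mul_restrictAxis_dividedDifference (j : ℕ) (f : MvPolynomial ℕ ℤ) :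
    Polynomial.X * restrictAxis j (dividedDifference j f) =
      restrictAxis j f - restrictAxis (j + 1) f := by
  rw [← restrictAxis_swapVars, ← map_sub, ← mul_dividedDifference, map_mul]
  simp [restrictAxis]

theorem constantCoeff_slice (p : ℕ) (f : MvPolynomial ℕ ℤ) :
    constantCoeff (slice p f) = (restrictAxis 0 f).coeff p := by
  have h : restrictAxis 0 f = (splitFirst f).map constantCoeff := by
    induction f using MvPolynomial.induction_on with
    | C a => simp [splitFirst, restrictAxis]
    | add p q hp hq => rw [map_add, map_add, hp, hq, Polynomial.map_add]
    | mul_X p k hp =>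
      rw [map_mul, map_mul, hp, Polynomial.map_mul]
      congr 1
      cases k with
      | zero => rw [splitFirst_X_zero]; simp [restrictAxis]
      | succ k => rw [splitFirst_X_succ]; simp [restrictAxis]
  rw [h, Polynomial.coeff_map, slice]

theorem restrictAxis_schubert_of_le {n j : ℕ} (w : Equiv.Perm (Fin n)) (hj : n ≤ j + 1) :
    restrictAxis j (schubert w) = if w = 1 then 1 else 0 := by
  have h := notMem_vars_schubert w hj
  rw [restrictAxis, aeval_eq_constantCoeff_of_vars, constantCoeff_schubert]
  · split_ifs <;> simp
  · intro k hk
    rw [if_neg]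
    rintro rfl
    exact h hk

end axis

/-! ### Left-to-right maxima -/

section records

variable {n : ℕ}

/-- The positions of `w` that are not left-to-right maxima. -/
def nonRecords (w : Equiv.Perm (Fin n)) : Finset ℕ :=
  (Finset.range n).filter fun k => ∃ i < k, entry w k < entry w i

theorem lt_of_lt_of_entry_lt {w : Equiv.Perm (Fin n)} {i k : ℕ} (hik : i < k)
    (h : entry w k < entry w i) : k < n := by
  by_contra hk
  rw [entry_of_le w (by omega : n ≤ k)] at h
  rcases lt_or_ge i n with hi | hi
  · have := entry_lt w hi
    omega
  · rw [entry_of_le w hi] at h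
    omega

theorem mem_nonRecords {w : Equiv.Perm (Fin n)} {k : ℕ} :
    k ∈ nonRecords w ↔ ∃ i < k, entry w k < entry w i := by
  simp only [nonRecords, Finset.mem_filter, Finset.mem_range, and_iff_right_iff_imp]
  rintro ⟨i, hi, h⟩
  exact lt_of_lt_of_entry_lt hi h

theorem mem_nonRecords_swapAt_self {w : Equiv.Perm (Fin n)} {j : ℕ}
    (h : entry w (j + 1) < entry w j) :
    j ∈ nonRecords (swapAt w j) ↔ ∃ k < j, entry w (j + 1) < entry w k := by
  have hj := succ_lt_of_descent h
  rw [mem_nonRecords]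
  refine exists_congr fun i => and_congr_right fun hi => ?_
  rw [entry_swapAt_left w hj, entry_swapAt_of_ne w (by omega) (by omega)]

theorem mem_nonRecords_swapAt {w : Equiv.Perm (Fin n)} {j k : ℕ}
    (h : entry w (j + 1) < entry w j) (hk : k ≠ j) :
    k ∈ nonRecords (swapAt w j) ↔ Equiv.swap j (j + 1) k ∈ nonRecords w := by
  have hj := succ_lt_of_descent h
  rw [mem_nonRecords, mem_nonRecords]
  rcases eq_or_ne k (j + 1) with rfl | hk1
  · rw [entry_swapAt_right w hj, Equiv.swap_apply_right]
    constructor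
    · rintro ⟨i, hi, hlt⟩
      rcases eq_or_ne i j with rfl | hij
      · rw [entry_swapAt_left w hj] at hlt
        omega
      · rw [entry_swapAt_of_ne w hij (by omega)] at hlt
        exact ⟨i, by omega, hlt⟩
    · rintro ⟨i, hi, hlt⟩
      refine ⟨i, by omega, ?_⟩
      rwa [entry_swapAt_of_ne w (by omega) (by omega)]
  · rw [entry_swapAt_of_ne w hk hk1, Equiv.swap_apply_of_ne_of_ne hk hk1]
    have hlt : ∀ i, i < k → Equiv.swap j (j + 1) i < k := by
      intro i hi
      rw [Equiv.swap_apply_def]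
      split_ifs <;> omega
    constructor
    · rintro ⟨i, hi, h1⟩
      rw [entry_swapAt w hj] at h1
      exact ⟨_, hlt i hi, h1⟩
    · rintro ⟨i, hi, h1⟩
      refine ⟨_, hlt i hi, ?_⟩
      rwa [entry_swapAt w hj, Equiv.swap_apply_self]

theorem card_nonRecords_swapAt_of_exists {w : Equiv.Perm (Fin n)} {j : ℕ}
    (h : entry w (j + 1) < entry w j) (hex : ∃ k < j, entry w (j + 1) < entry w k) :
    (nonRecords (swapAt w j)).card = (nonRecords w).card := by
  apply Finset.card_equiv (Equiv.swap j (j + 1))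
  intro k
  rcases eq_or_ne k j with rfl | hk
  · rw [mem_nonRecords_swapAt_self h, Equiv.swap_apply_left, mem_nonRecords]
    exact iff_of_true hex ⟨k, by omega, h⟩
  · exact mem_nonRecords_swapAt h hk

theorem card_nonRecords_swapAt_of_not_exists {w : Equiv.Perm (Fin n)} {j : ℕ}
    (h : entry w (j + 1) < entry w j) (hex : ¬ ∃ k < j, entry w (j + 1) < entry w k) :
    (nonRecords (swapAt w j)).card + 1 = (nonRecords w).card := by
  have hmem : j + 1 ∈ nonRecords w := mem_nonRecords.mpr ⟨j, by omega, h⟩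
  rw [← Finset.card_erase_add_one hmem]
  congr 1
  apply Finset.card_equiv (Equiv.swap j (j + 1))
  intro k
  rw [Finset.mem_erase]
  rcases eq_or_ne k j with rfl | hk
  · rw [mem_nonRecords_swapAt_self h, Equiv.swap_apply_left]
    simp only [ne_eq, not_true, false_and, iff_false]
    exact hex
  · rw [mem_nonRecords_swapAt h hk, and_iff_right]
    rw [ne_eq, Equiv.swap_apply_eq_iff, Equiv.swap_apply_right]
    exact hk

theorem card_nonRecords_swapAt_le {w : Equiv.Perm (Fin n)} {j : ℕ}
    (h : entry w (j + 1) < entry w j) :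
    (nonRecords (swapAt w j)).card ≤ (nonRecords w).card := by
  by_cases hex : ∃ k < j, entry w (j + 1) < entry w k
  · exact (card_nonRecords_swapAt_of_exists h hex).le
  · have := card_nonRecords_swapAt_of_not_exists h hex
    omega

theorem nonRecords_one : nonRecords (1 : Equiv.Perm (Fin n)) = ∅ := by
  rw [Finset.eq_empty_iff_forall_notMem]
  intro k hk
  obtain ⟨i, hi, h⟩ := mem_nonRecords.mp hk
  rw [entry_one, entry_one] at h
  omega

/-- Every entry has at most one larger entry on its left. -/
def AtMostOneLarger (w : Equiv.Perm (Fin n)) : Prop :=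
  ∀ i i' k, i < k → i' < k → entry w k < entry w i → entry w k < entry w i' → i = i'

theorem le_entry_of_fixed {w : Equiv.Perm (Fin n)} {j k : ℕ} (hfix : ∀ k < j, entry w k = k)
    (hk : j ≤ k) : j ≤ entry w k := by
  by_contra h
  have := entry_injective w (hfix (entry w k) (by omega))
  omega

theorem atMostOneLarger_swapAt_iff {w : Equiv.Perm (Fin n)} {j : ℕ}
    (h : entry w (j + 1) < entry w j) (hfix : ∀ k < j, entry w k = k) :
    AtMostOneLarger (swapAt w j) ↔ AtMostOneLarger w := by
  have hj := succ_lt_of_descent h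
  have hge := fun k (hk : j ≤ k) => le_entry_of_fixed hfix hk
  have hlt : ∀ i k, i < k → j + 1 < k → Equiv.swap j (j + 1) i < k := by
    intro i k hi hk
    rw [Equiv.swap_apply_def]
    split_ifs <;> omega
  have hge1 := hge j le_rfl
  have hge2 := hge (j + 1) (by omega)
  constructor
  · intro hu i i' k hi hi' h1 h2
    rcases lt_or_ge (j + 1) k with hk | hk
    · apply (Equiv.swap j (j + 1)).injective
      apply hu _ _ k (hlt _ _ hi hk) (hlt _ _ hi' hk)
      · rwa [entry_swapAt_of_ne w (by omega) (by omega), entry_swapAt w hj, Equiv.swap_apply_self]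
      · rwa [entry_swapAt_of_ne w (by omega) (by omega), entry_swapAt w hj, Equiv.swap_apply_self]
    · have hij : ∀ i, i < k → entry w k < entry w i → i = j := by
        intro i hi h1
        by_contra hne
        have h3 := hfix i (by omega)
        rcases lt_or_ge k j with h4 | h4
        · have := hfix k h4
          omega
        · have := hge k h4
          omega
      rw [hij i hi h1, hij i' hi' h2]
  · intro hw i i' k hi hi' h1 h2
    rcases lt_or_ge (j + 1) k with hk | hk
    · rw [entry_swapAt_of_ne w (by omega) (by omega), entry_swapAt w hj] at h1 h2
      exact (Equiv.swap j (j + 1)).injective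
        (hw _ _ k (hlt _ _ hi hk) (hlt _ _ hi' hk) h1 h2)
    · exfalso
      rcases eq_or_ne i j with rfl | hij
      · obtain rfl : k = i + 1 := by omega
        rw [entry_swapAt_right w hj, entry_swapAt_left w hj] at h1
        omega
      · have h3 := hfix i (by omega)
        rw [entry_swapAt_of_ne w (k := i) (by omega) (by omega)] at h1
        rcases lt_trichotomy k j with h4 | rfl | h4
        · have := hfix k h4
          rw [entry_swapAt_of_ne w (by omega) (by omega)] at h1
          omega
        · rw [entry_swapAt_left w hj] at h1
          omega
        · obtain rfl : k = j + 1 := by omega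
          rw [entry_swapAt_right w hj] at h1
          omega

open Classical in
/-- The pure powers of a single variable in a Schubert polynomial. The two sides agree because both
satisfy the recursion `ε j (𝔖 w) = ε (j + 1) (𝔖 w) + t * ε j (∂ⱼ 𝔖 w)`, where `ε j` is the
restriction to the `j`-th axis. -/
theorem restrictAxis_schubert (w : Equiv.Perm (Fin n)) (j : ℕ) :
    restrictAxis j (schubert w) =
      if AtMostOneLarger w ∧ ∀ k < j, entry w k = k then
        Polynomial.X ^ (nonRecords w).card else 0 := by
  induction w using descent_induction generalizing j with
  | step w ih =>
    obtain ⟨d, hd⟩ : ∃ d, n ≤ j + 1 + d := ⟨n, by omega⟩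
    induction d generalizing j with
    | zero =>
      rw [restrictAxis_schubert_of_le w hd]
      by_cases hw : w = 1
      · subst hw
        rw [if_pos rfl, if_pos, nonRecords_one]
        · simp
        · refine ⟨fun i i' k hi _ h1 _ => ?_, fun k _ => entry_one k⟩
          rw [entry_one, entry_one] at h1
          omega
      · rw [if_neg hw, if_neg]
        rintro ⟨-, hfix⟩
        apply hw
        apply eq_of_entry_eq
        intro k hk
        rw [entry_one]
        rcases lt_or_ge k j with h | h
        · exact hfix k h
        · have h1 := le_entry_of_fixed hfix h
          have h2 := entry_lt w hk
          omega
    | succ d ihd =>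
      have hrec := X_mul_restrictAxis_dividedDifference j (schubert w)
      rw [ihd (j + 1) (by omega)] at hrec
      rcases entry_lt_or_gt w j with hasc | hdesc
      · rw [dividedDifference_schubert_of_ascent w hasc, map_zero, mul_zero] at hrec
        rw [sub_eq_zero.mp hrec.symm]
        refine if_congr (and_congr_right fun hw => ⟨fun h k hk => h k (by omega), ?_⟩) rfl rfl
        intro hfix k hk
        rcases Nat.lt_succ_iff_lt_or_eq.mp hk with h | rfl
        · exact hfix k h
        rcases lt_or_ge k n with hkn | hkn
        swap
        · exact entry_of_le w hkn
        -- If `j` is not fixed, then the value `j` has both `w j` and `w (j + 1)` on its left.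
        obtain ⟨x, -, hx⟩ := exists_entry_eq w hkn
        by_contra hne
        have hxk : x ≠ k := by rintro rfl; exact hne hx
        have hkx : k < x := by
          by_contra hlt
          have := hfix x (by omega)
          omega
        have h1 := le_entry_of_fixed hfix (le_refl k)
        have hx1 : x ≠ k + 1 := by rintro rfl; omega
        have := hw k (k + 1) x hkx (by omega) (by omega) (by omega)
        omega
      · rw [dividedDifference_schubert_of_descent w hdesc, ih j hdesc,
          if_neg (c := AtMostOneLarger w ∧ ∀ k < j + 1, entry w k = k), sub_zero] at hrec
        · rw [← hrec]
          by_cases hfix : ∀ k < j, entry w k = k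
          · have hfix' : ∀ k < j, entry (swapAt w j) k = k := fun k hk => by
              rw [entry_swapAt_of_ne w (by omega) (by omega), hfix k hk]
            have hcard := card_nonRecords_swapAt_of_not_exists hdesc (by
              rintro ⟨k, hk, hlt⟩
              have h1 := hfix k hk
              have h2 := le_entry_of_fixed hfix (by omega : j ≤ j + 1)
              omega)
            rw [atMostOneLarger_swapAt_iff hdesc hfix, ← hcard]
            by_cases hw : AtMostOneLarger w
            · rw [if_pos ⟨hw, hfix'⟩, if_pos ⟨hw, hfix⟩, pow_succ, mul_comm]
            · rw [if_neg (fun h => hw h.1), if_neg (fun h => hw h.1), mul_zero]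
          · rw [if_neg (c := AtMostOneLarger w ∧ ∀ k < j, entry w k = k) (fun h => hfix h.2),
              if_neg, mul_zero]
            rintro ⟨-, h⟩
            apply hfix
            intro k hk
            have := h k hk
            rwa [entry_swapAt_of_ne w (by omega) (by omega)] at this
        · rintro ⟨-, hfix⟩
          have h1 := hfix j (by omega)
          have h2 := le_entry_of_fixed hfix (le_refl (j + 1))
          omega

open Classical in
theorem constantCoeff_slice_schubert (w : Equiv.Perm (Fin n)) (p : ℕ) :
    constantCoeff (slice p (schubert w)) =
      if AtMostOneLarger w ∧ p = (nonRecords w).card then 1 else 0 := by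
  rw [constantCoeff_slice, restrictAxis_schubert]
  by_cases hw : AtMostOneLarger w
  · simp [hw, Polynomial.coeff_X_pow]
  · simp [hw]

end records

/-! ### The two extreme slices -/

section extreme

variable {n : ℕ}

/-- The permutation of `Fin n` whose one-line notation is `f 0, …, f (n - 1)`. -/
noncomputable def permOfFun (n : ℕ) (f : ℕ → ℕ) (hf : ∀ k < n, f k < n)
    (hinj : ∀ a b, a < b → b < n → f a ≠ f b) : Equiv.Perm (Fin n) :=
  Equiv.ofBijective (fun k => ⟨f k, hf k k.2⟩) <| Finite.injective_iff_bijective.mp fun a b hab => by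
    have hab : f a = f b := congrArg Fin.val hab
    rcases lt_trichotomy a b with h | h | h
    · exact absurd hab (hinj a b h b.2)
    · exact h
    · exact absurd hab.symm (hinj b a h a.2)

theorem entry_permOfFun {f : ℕ → ℕ} (hf : ∀ k < n, f k < n)
    (hinj : ∀ a b, a < b → b < n → f a ≠ f b) {k : ℕ} (hk : k < n) :
    entry (permOfFun n f hf hinj) k = f k := by
  rw [entry_of_lt _ hk]
  rfl

/-- The pattern of the entries `w₂, …, wₙ₊₁` of `w`. -/
noncomputable def tail (w : Equiv.Perm (Fin (n + 1))) : Equiv.Perm (Fin n) :=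
  permOfFun n
    (fun k => if entry w (k + 1) < entry w 0 then entry w (k + 1) else entry w (k + 1) - 1)
    (fun k hk => by
      have h1 := entry_lt w (by omega : k + 1 < n + 1)
      have h2 := entry_lt w (by omega : 0 < n + 1)
      have h3 : entry w (k + 1) ≠ entry w 0 := fun h => by
        have := entry_injective w h
        omega
      split_ifs <;> omega)
    (fun a b hab _ => by
      have h1 : entry w (a + 1) ≠ entry w 0 := fun h => by
        have := entry_injective w h
        omega
      have h2 : entry w (b + 1) ≠ entry w 0 := fun h => by
        have := entry_injective w h
        omega
      have h3 : entry w (a + 1) ≠ entry w (b + 1) := fun h => by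
        have := entry_injective w h
        omega
      split_ifs <;> omega)

theorem entry_succ_ne_entry_zero (w : Equiv.Perm (Fin n)) (k : ℕ) :
    entry w (k + 1) ≠ entry w 0 := fun h => by
  have := entry_injective w h
  omega

theorem entry_tail (w : Equiv.Perm (Fin (n + 1))) (k : ℕ) :
    entry (tail w) k =
      if entry w (k + 1) < entry w 0 then entry w (k + 1) else entry w (k + 1) - 1 := by
  rcases lt_or_ge k n with hk | hk
  · exact entry_permOfFun _ _ hk
  · have := entry_lt w (by omega : 0 < n + 1)
    rw [entry_of_le _ hk, entry_of_le w (by omega : n + 1 ≤ k + 1), if_neg (by omega)]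
    omega

theorem entry_tail_lt_iff (w : Equiv.Perm (Fin (n + 1))) (a b : ℕ) :
    entry (tail w) a < entry (tail w) b ↔ entry w (a + 1) < entry w (b + 1) := by
  have h1 := entry_succ_ne_entry_zero w a
  have h2 := entry_succ_ne_entry_zero w b
  rw [entry_tail, entry_tail]
  split_ifs <;> omega

theorem tail_swapAt (w : Equiv.Perm (Fin (n + 1))) {j : ℕ} (hj : j + 1 < n) :
    tail (swapAt w (j + 1)) = swapAt (tail w) j := by
  apply eq_of_entry_eq
  intro k _
  have h : Equiv.swap (j + 1) (j + 1 + 1) (k + 1) = Equiv.swap j (j + 1) k + 1 := by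
    simp only [Equiv.swap_apply_def]
    split_ifs <;> omega
  rw [entry_swapAt _ hj, entry_tail, entry_tail, entry_swapAt w (by omega),
    entry_swapAt_of_ne w (by omega) (by omega), h]

/-- The largest of the entries of `w` in the positions `0, …, k`. -/
noncomputable def prefixMax (w : Equiv.Perm (Fin n)) (k : ℕ) : ℕ :=
  (Finset.range (k + 1)).sup (entry w)

theorem le_prefixMax (w : Equiv.Perm (Fin n)) {i k : ℕ} (h : i ≤ k) :
    entry w i ≤ prefixMax w k :=
  Finset.le_sup (f := entry w) (Finset.mem_range.mpr (Nat.lt_succ_of_le h))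

theorem lt_prefixMax_iff {w : Equiv.Perm (Fin n)} {x k : ℕ} :
    x < prefixMax w k ↔ ∃ i ≤ k, x < entry w i := by
  simp [prefixMax, Finset.lt_sup_iff]

theorem exists_prefixMax_eq (w : Equiv.Perm (Fin n)) (k : ℕ) :
    ∃ i ≤ k, prefixMax w k = entry w i := by
  obtain ⟨i, hi, h⟩ := Finset.exists_mem_eq_sup (Finset.range (k + 1)) ⟨0, by simp⟩ (entry w)
  exact ⟨i, by simpa using hi, h⟩

theorem prefixMax_ne_entry_succ (w : Equiv.Perm (Fin n)) (k : ℕ) :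
    prefixMax w k ≠ entry w (k + 1) := by
  obtain ⟨i, hi, h⟩ := exists_prefixMax_eq w k
  rw [h]
  intro h
  have := entry_injective w h
  omega

theorem min_prefixMax_ne (w : Equiv.Perm (Fin n)) {a b : ℕ} (hab : a < b) :
    min (entry w (a + 1)) (prefixMax w a) ≠ min (entry w (b + 1)) (prefixMax w b) := by
  obtain ⟨i, hi, hM⟩ := exists_prefixMax_eq w a
  have h1 : entry w (a + 1) ≤ prefixMax w b := le_prefixMax w hab
  have h2 : entry w i ≤ prefixMax w b := le_prefixMax w (hi.trans hab.le)
  have h3 : entry w i ≠ entry w (a + 1) := fun h => by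
    have := entry_injective w h
    omega
  have h4 : entry w i ≠ entry w (b + 1) := fun h => by
    have := entry_injective w h
    omega
  have h5 : entry w (a + 1) ≠ entry w (b + 1) := fun h => by
    have := entry_injective w h
    omega
  omega

/-- Remove the largest entry of `w` as follows: replace every left-to-right maximum of `w` by the
preceding one, and drop the first position. Equivalently, the entry in position `k` is the smaller
one of `w (k + 1)` and the maximum of the entries of `w` before it. -/
noncomputable def lowerRecords (w : Equiv.Perm (Fin (n + 1))) : Equiv.Perm (Fin n) :=
  permOfFun n (fun k => min (entry w (k + 1)) (prefixMax w k))
    (fun k hk => by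
      have h1 := entry_lt w (by omega : k + 1 < n + 1)
      obtain ⟨i, hi, h⟩ := exists_prefixMax_eq w k
      have h2 := entry_lt w (by omega : i < n + 1)
      have h3 := prefixMax_ne_entry_succ w k
      omega)
    (fun _ _ hab _ => min_prefixMax_ne w hab)

theorem entry_lowerRecords (w : Equiv.Perm (Fin (n + 1))) {k : ℕ} (hk : k < n) :
    entry (lowerRecords w) k = min (entry w (k + 1)) (prefixMax w k) :=
  entry_permOfFun _ _ hk

theorem entry_lowerRecords_lt_iff (w : Equiv.Perm (Fin (n + 1))) {a b : ℕ} (hab : a < b)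
    (hb : b < n) : entry (lowerRecords w) b < entry (lowerRecords w) a ↔
      entry w (b + 1) < entry w (a + 1) ∧ ∃ i ≤ a, entry w (b + 1) < entry w i := by
  rw [entry_lowerRecords w hb, entry_lowerRecords w (hab.trans hb), ← lt_prefixMax_iff]
  have h1 : entry w (a + 1) ≤ prefixMax w b := le_prefixMax w hab
  omega

theorem lowerRecords_swapAt {w : Equiv.Perm (Fin (n + 1))} {j : ℕ}
    (h : entry w (j + 1 + 1) < entry w (j + 1))
    (hex : ∃ i < j + 1, entry w (j + 1 + 1) < entry w i) :
    lowerRecords (swapAt w (j + 1)) = swapAt (lowerRecords w) j := by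
  have hj := succ_lt_of_descent h
  have hjn : j + 1 < n := by omega
  obtain ⟨i, hi, hlt⟩ := hex
  have hpre : ∀ k, k ≠ j + 1 → prefixMax (swapAt w (j + 1)) k = prefixMax w k := by
    intro k hk
    apply le_antisymm <;> refine Finset.sup_le fun i hi => ?_
    · rw [entry_swapAt w hj]
      apply le_prefixMax
      rw [Finset.mem_range] at hi
      simp only [Equiv.swap_apply_def]
      split_ifs <;> omega
    · rw [← swapAt_swapAt w (j + 1), entry_swapAt _ hj, swapAt_swapAt]
      apply le_prefixMax
      rw [Finset.mem_range] at hi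
      simp only [Equiv.swap_apply_def]
      split_ifs <;> omega
  have hsucc : ∀ (u : Equiv.Perm (Fin (n + 1))) k,
      prefixMax u (k + 1) = max (prefixMax u k) (entry u (k + 1)) := by
    intro u k
    rw [prefixMax, Finset.range_add_one, Finset.sup_insert, max_comm]
    rfl
  have hm : entry w (j + 1 + 1) < prefixMax w j := lt_prefixMax_iff.mpr ⟨i, by omega, hlt⟩
  apply eq_of_entry_eq
  intro k hk
  rw [entry_lowerRecords _ hk]
  rcases eq_or_ne k j with rfl | h1
  · rw [entry_swapAt_left _ hjn, entry_lowerRecords _ hjn, entry_swapAt_left w hj,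
      hpre _ (by omega), hsucc]
    omega
  rcases eq_or_ne k (j + 1) with rfl | h2
  · rw [entry_swapAt_right _ hjn, entry_lowerRecords _ (by omega), entry_swapAt_right w hj,
      hsucc, hpre _ (by omega), entry_swapAt_left w hj]
    omega
  · rw [entry_swapAt_of_ne _ h1 h2, entry_lowerRecords _ hk,
      entry_swapAt_of_ne w (by omega) (by omega), hpre _ h2]

theorem range_subset_image_nonRecords (w : Equiv.Perm (Fin n)) :
    Finset.range (entry w 0) ⊆ (nonRecords w).image (entry w) := by
  intro x hx
  rw [Finset.mem_range] at hx
  have hn : 0 < n := by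
    by_contra h
    rw [entry_of_le w (by omega)] at hx
    omega
  obtain ⟨k, -, hk⟩ := exists_entry_eq w (hx.trans (entry_lt w hn))
  refine Finset.mem_image.mpr ⟨k, mem_nonRecords.mpr ⟨0, ?_, by omega⟩, hk⟩
  by_contra h0
  obtain rfl : k = 0 := by omega
  omega

theorem card_image_nonRecords (w : Equiv.Perm (Fin n)) :
    ((nonRecords w).image (entry w)).card = (nonRecords w).card :=
  Finset.card_image_of_injective _ (entry_injective w)

theorem entry_zero_le_card_nonRecords (w : Equiv.Perm (Fin n)) :
    entry w 0 ≤ (nonRecords w).card := by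
  have := Finset.card_le_card (range_subset_image_nonRecords w)
  rwa [Finset.card_range, card_image_nonRecords] at this

theorem card_nonRecords_eq_entry_zero_iff (w : Equiv.Perm (Fin n)) :
    (nonRecords w).card = entry w 0 ↔
      ∀ i k, i < k → entry w k < entry w i → entry w k < entry w 0 := by
  constructor
  · intro h i k hik hlt
    have heq := Finset.eq_of_subset_of_card_le (range_subset_image_nonRecords w)
      (by rw [card_image_nonRecords, h, Finset.card_range])
    rw [← Finset.mem_range, heq]
    exact Finset.mem_image_of_mem _ (mem_nonRecords.mpr ⟨i, hik, hlt⟩)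
  · intro h
    apply le_antisymm _ (entry_zero_le_card_nonRecords w)
    rw [← card_image_nonRecords]
    conv_rhs => rw [← Finset.card_range (entry w 0)]
    apply Finset.card_le_card
    intro x hx
    obtain ⟨k, hk, rfl⟩ := Finset.mem_image.mp hx
    obtain ⟨i, hik, hlt⟩ := mem_nonRecords.mp hk
    exact Finset.mem_range.mpr (h i k hik hlt)

theorem tail_eq_one_iff (w : Equiv.Perm (Fin (n + 1))) :
    tail w = 1 ↔ AtMostOneLarger w ∧ (nonRecords w).card = entry w 0 := by
  rw [card_nonRecords_eq_entry_zero_iff]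
  constructor
  · intro h
    have hz : ∀ i k, i < k → entry w k < entry w i → i = 0 := by
      intro i k hik hlt
      by_contra hi
      obtain ⟨i, rfl⟩ := Nat.exists_eq_succ_of_ne_zero hi
      obtain ⟨k, rfl⟩ := Nat.exists_eq_succ_of_ne_zero (by omega : k ≠ 0)
      have := (entry_tail_lt_iff w k i).mpr hlt
      rw [h, entry_one, entry_one] at this
      omega
    refine ⟨fun i i' k hi hi' h1 h2 => ?_, fun i k hi h1 => ?_⟩
    · rw [hz i k hi h1, hz i' k hi' h2]
    · rwa [hz i k hi h1] at h1
  · rintro ⟨h1, h2⟩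
    apply eq_one_of_forall_ascent
    intro a
    refine (entry_lt_or_gt _ a).resolve_right fun h => ?_
    rw [entry_tail_lt_iff] at h
    have h3 := h2 (a + 1) (a + 1 + 1) (by omega) h
    have := h1 (a + 1) 0 (a + 1 + 1) (by omega) (by omega) h h3
    omega

theorem lowerRecords_eq_one_iff (w : Equiv.Perm (Fin (n + 1))) :
    lowerRecords w = 1 ↔ AtMostOneLarger w := by
  constructor
  · intro h
    have key : ∀ i i' k, i < i' → i' < k → entry w k < entry w i → entry w k < entry w i' →
        False := by
      intro i i' k hi hi' h1 h2
      have hk := lt_of_lt_of_entry_lt hi' h2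
      obtain ⟨a, rfl⟩ := Nat.exists_eq_succ_of_ne_zero (by omega : i' ≠ 0)
      obtain ⟨b, rfl⟩ := Nat.exists_eq_succ_of_ne_zero (by omega : k ≠ 0)
      have := (entry_lowerRecords_lt_iff w (by omega : a < b) (by omega)).mpr
        ⟨h2, i, by omega, h1⟩
      rw [h, entry_one, entry_one] at this
      omega
    intro i i' k hi hi' h1 h2
    rcases lt_trichotomy i i' with hlt | heq | hlt
    · exact (key i i' k hlt hi' h1 h2).elim
    · exact heq
    · exact (key i' i k hlt hi h2 h1).elim
  · intro h
    apply eq_one_of_forall_ascent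
    intro a
    refine (entry_lt_or_gt _ a).resolve_right fun hd => ?_
    rw [entry_lowerRecords_lt_iff w (by omega) (succ_lt_of_descent hd)] at hd
    obtain ⟨h1, i, hi, h2⟩ := hd
    have := h i (a + 1) (a + 1 + 1) (by omega) (by omega) h2 h1
    omega

/-- The lowest power of `x₁` in `𝔖 w` has exponent `w₁ - 1`, and its coefficient is the Schubert
polynomial of the pattern of the other entries. -/
theorem slice_schubert_of_le (w : Equiv.Perm (Fin (n + 1))) {p : ℕ} (hp : p ≤ entry w 0) :
    slice p (schubert w) = if p = entry w 0 then schubert (tail w) else 0 := by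
  induction w using descent_induction with
  | step w ih =>
    apply eq_of_dividedDifference_eq
    · intro i
      rw [dividedDifference_slice]
      rcases entry_lt_or_gt w (i + 1) with h | h
      · rw [dividedDifference_schubert_of_ascent w h, slice_zero]
        split_ifs
        · rw [dividedDifference_schubert_of_ascent _ ((entry_tail_lt_iff w _ _).mpr h)]
        · rw [dividedDifference_zero]
      · have h0 : entry (swapAt w (i + 1)) 0 = entry w 0 :=
          entry_swapAt_of_ne w (by omega) (by omega)
        have := succ_lt_of_descent h
        rw [dividedDifference_schubert_of_descent w h, ih _ h (h0.symm ▸ hp), h0,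
          tail_swapAt w (by omega)]
        split_ifs
        · rw [dividedDifference_schubert_of_descent _ ((entry_tail_lt_iff w _ _).mpr h)]
        · rw [dividedDifference_zero]
    · rw [constantCoeff_slice_schubert]
      have hle := entry_zero_le_card_nonRecords w
      have hiff := tail_eq_one_iff w
      split_ifs with h1 h2 h2
      · rw [constantCoeff_schubert, if_pos (hiff.mpr ⟨h1.1, by omega⟩)]
      · omega
      · rw [constantCoeff_schubert, if_neg]
        intro h
        have := hiff.mp h
        exact h1 ⟨this.1, by omega⟩
      · rw [map_zero]

/-- The highest power of `x₁` in `𝔖 w` is the number of positions of `w` that are not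
left-to-right maxima, and its coefficient is the Schubert polynomial of `lowerRecords w`. -/
theorem slice_schubert_of_ge (w : Equiv.Perm (Fin (n + 1))) {p : ℕ}
    (hp : (nonRecords w).card ≤ p) :
    slice p (schubert w) =
      if p = (nonRecords w).card then schubert (lowerRecords w) else 0 := by
  induction w using descent_induction with
  | step w ih =>
    apply eq_of_dividedDifference_eq
    · intro i
      rw [dividedDifference_slice]
      rcases entry_lt_or_gt w (i + 1) with h | h
      · rw [dividedDifference_schubert_of_ascent w h, slice_zero]
        split_ifs
        · rw [dividedDifference_schubert_of_ascent]
          refine (entry_lt_or_gt _ i).resolve_right fun hd => ?_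
          rw [entry_lowerRecords_lt_iff w (by omega) (succ_lt_of_descent hd)] at hd
          omega
        · rw [dividedDifference_zero]
      · have hin := succ_lt_of_descent h
        rw [dividedDifference_schubert_of_descent w h,
          ih _ h ((card_nonRecords_swapAt_le h).trans hp)]
        by_cases hex : ∃ k < i + 1, entry w (i + 1 + 1) < entry w k
        · rw [card_nonRecords_swapAt_of_exists h hex, lowerRecords_swapAt h hex]
          split_ifs
          · rw [dividedDifference_schubert_of_descent]
            rw [entry_lowerRecords_lt_iff w (by omega) (by omega)]
            obtain ⟨k, hk, hlt⟩ := hex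
            exact ⟨h, k, by omega, hlt⟩
          · rw [dividedDifference_zero]
        -- Otherwise swapping creates a new left-to-right maximum, so the top power drops out, and
        -- correspondingly `lowerRecords w` has an ascent.
        · have := card_nonRecords_swapAt_of_not_exists h hex
          rw [if_neg (by omega)]
          split_ifs
          · rw [dividedDifference_schubert_of_ascent]
            refine (entry_lt_or_gt _ i).resolve_right fun hd => hex ?_
            rw [entry_lowerRecords_lt_iff w (by omega) (succ_lt_of_descent hd)] at hd
            obtain ⟨-, k, hk, hlt⟩ := hd
            exact ⟨k, by omega, hlt⟩
          · rw [dividedDifference_zero]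
    · rw [constantCoeff_slice_schubert]
      by_cases hpc : p = (nonRecords w).card
      · rw [if_pos hpc, constantCoeff_schubert]
        have hiff := (and_iff_left hpc).trans (lowerRecords_eq_one_iff w).symm
        split_ifs <;> first | rfl | tauto
      · rw [if_neg hpc, if_neg (fun h => hpc h.2), map_zero]

end extreme

/-! ### Stability -/

section stability

/-- Stability: Schubert polynomials do not change under `Sₘ ⊆ Sₙ`. -/
theorem schubert_eq_of_entry_eq {m n : ℕ} {u : Equiv.Perm (Fin m)} {v : Equiv.Perm (Fin n)}
    (h : ∀ k, entry u k = entry v k) : schubert u = schubert v := by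
  induction u using descent_induction generalizing v with
  | step u ih =>
    apply eq_of_dividedDifference_eq
    · intro i
      rcases entry_lt_or_gt u i with hi | hi
      · rw [dividedDifference_schubert_of_ascent u hi, dividedDifference_schubert_of_ascent]
        rwa [← h, ← h]
      · have hv : entry v (i + 1) < entry v i := by rwa [← h, ← h]
        rw [dividedDifference_schubert_of_descent u hi,
          dividedDifference_schubert_of_descent v hv]
        apply ih i hi
        intro k
        rw [entry_swapAt u (succ_lt_of_descent hi), entry_swapAt v (succ_lt_of_descent hv), h]
    · have hiff : u = 1 ↔ v = 1 := by
        constructor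
        · rintro rfl
          exact eq_of_entry_eq fun k _ => by rw [← h, entry_one, entry_one]
        · rintro rfl
          exact eq_of_entry_eq fun k _ => by rw [h, entry_one, entry_one]
      rw [constantCoeff_schubert, constantCoeff_schubert]
      exact if_congr hiff rfl rfl

theorem exists_schubert_eq_succ {n : ℕ} (u : Equiv.Perm (Fin n)) :
    ∃ v : Equiv.Perm (Fin (n + 1)), schubert v = schubert u := by
  refine ⟨permOfFun (n + 1) (entry u) (fun k hk => ?_)
    (fun a b hab _ h => hab.ne (entry_injective u h)), schubert_eq_of_entry_eq fun k => ?_⟩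
  · rcases lt_or_ge k n with h | h
    · exact (entry_lt u h).trans (Nat.lt_succ_self n)
    · rwa [entry_of_le u h]
  · rcases lt_or_ge k (n + 1) with h | h
    · exact entry_permOfFun _ _ h
    · rw [entry_of_le _ h, entry_of_le _ (by omega)]

theorem exists_schubert_eq_pred {n : ℕ} (v : Equiv.Perm (Fin (n + 1))) (hv : entry v n = n) :
    ∃ u : Equiv.Perm (Fin n), schubert u = schubert v := by
  refine ⟨permOfFun n (entry v) (fun k hk => ?_)
    (fun a b hab _ h => hab.ne (entry_injective v h)), schubert_eq_of_entry_eq fun k => ?_⟩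
  · have h1 := entry_lt v (by omega : k < n + 1)
    have h2 : entry v k ≠ entry v n := fun h => hk.ne (entry_injective v h)
    omega
  · rcases lt_trichotomy k n with h | rfl | h
    · exact entry_permOfFun _ _ h
    · rw [entry_of_le _ le_rfl, hv]
    · rw [entry_of_le _ h.le, entry_of_le _ h]

theorem slice_schubert_entry_zero {n : ℕ} (w : Equiv.Perm (Fin (n + 1))) :
    slice (entry w 0) (schubert w) = schubert (tail w) := by
  rw [slice_schubert_of_le w le_rfl, if_pos rfl]

/-- If `v ∈ Sₙ₊₁` does not fix the last position, then some exponent of `𝔖 v` exceeds the staircase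
of `Sₙ`. -/
theorem exists_coeff_schubert_ne_zero {n : ℕ} (v : Equiv.Perm (Fin (n + 1)))
    (hv : entry v n ≠ n) : ∃ m, coeff m (schubert v) ≠ 0 ∧ ¬ m ≤ staircase n := by
  induction n with
  | zero =>
    have := entry_lt v (by omega : 0 < 0 + 1)
    omega
  | succ n ih =>
    have key : ∀ m, coeff m (schubert (tail v)) ≠ 0 → ¬ (entry v 0 ≤ n ∧ m ≤ staircase n) →
        ∃ m, coeff m (schubert v) ≠ 0 ∧ ¬ m ≤ staircase (n + 1) := by
      intro m hm hle
      refine ⟨consExponent (entry v 0) m, ?_, ?_⟩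
      · rwa [← coeff_slice, slice_schubert_entry_zero]
      · rwa [staircase_succ, consExponent_le]
    by_cases h0 : entry v 0 ≤ n
    · obtain ⟨m, hm, hle⟩ := ih (tail v) (by
        have h1 := entry_lt v (by omega : n + 1 < n + 1 + 1)
        have h2 := entry_succ_ne_entry_zero v n
        rw [entry_tail]
        split_ifs <;> omega)
      exact key m hm fun h => hle h.2
    · obtain ⟨m, hm⟩ := ne_zero_iff.mp (schubert_ne_zero (tail v))
      exact key m hm fun h => h0 h.1

theorem staircase_mono {m n : ℕ} (h : m ≤ n) : staircase m ≤ staircase n := fun k => by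
  rw [staircase_apply, staircase_apply]
  omega

/-- A Schubert polynomial with exponents below the staircase of `Sₙ` comes from `Sₙ`. -/
theorem exists_schubert_eq_of_le_staircase {m n : ℕ} (v : Equiv.Perm (Fin m))
    (hv : ∀ k, coeff k (schubert v) ≠ 0 → k ≤ staircase n) :
    ∃ u : Equiv.Perm (Fin n), schubert u = schubert v := by
  rcases le_total m n with hmn | hmn
  · induction n, hmn using Nat.le_induction with
    | base => exact ⟨v, rfl⟩
    | succ n _ ih =>
      have hvm : ∀ k, coeff k (schubert v) ≠ 0 → k ≤ staircase n := fun k hk =>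
        (le_staircase_of_coeff_schubert_ne_zero v hk).trans (staircase_mono ‹_›)
      obtain ⟨u, hu⟩ := ih hvm
      obtain ⟨u', hu'⟩ := exists_schubert_eq_succ u
      exact ⟨u', hu'.trans hu⟩
  · induction m, hmn using Nat.le_induction with
    | base => exact ⟨v, rfl⟩
    | succ m hnm ih =>
      have hlast : entry v m = m := by
        by_contra hne
        obtain ⟨k, hk, hle⟩ := exists_coeff_schubert_ne_zero v hne
        exact hle ((hv k hk).trans (staircase_mono hnm))
      obtain ⟨u, hu⟩ := exists_schubert_eq_pred v hlast
      obtain ⟨u', hu'⟩ := ih u (hu ▸ hv)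
      exact ⟨u', hu'.trans hu⟩

end stability

/-! ### Permutations whose Schubert polynomials are complements of each other -/

section pairs

variable {n : ℕ}

theorem card_nonRecords_of_avoids132 {w : Equiv.Perm (Fin n)} (hw : Avoids132 w) :
    (nonRecords w).card = entry w 0 := by
  rw [avoids132_iff] at hw
  rw [card_nonRecords_eq_entry_zero_iff]
  intro i k hik hlt
  rcases Nat.eq_zero_or_pos i with rfl | hi
  · exact hlt
  by_contra h
  have : entry w k ≠ entry w 0 := fun h => by
    have := entry_injective w h
    omega
  exact hw ⟨0, i, k, hi, hik, by omega, hlt⟩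

theorem card_nonRecords_tail {w : Equiv.Perm (Fin (n + 1))} (h : entry w 0 < entry w 1) :
    (nonRecords w).card = (nonRecords (tail w)).card := by
  rw [← Finset.card_image_of_injective (nonRecords (tail w)) Nat.succ_injective]
  congr 1
  ext k
  rw [Finset.mem_image, mem_nonRecords]
  constructor
  · rintro ⟨i, hi, hlt⟩
    obtain ⟨k, rfl⟩ := Nat.exists_eq_succ_of_ne_zero (by omega : k ≠ 0)
    refine ⟨k, mem_nonRecords.mpr ?_, rfl⟩
    rcases Nat.eq_zero_or_pos i with rfl | hi0
    · have hk : k ≠ 0 := by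
        rintro rfl
        exact absurd hlt (by simpa using h.le)
      exact ⟨0, by omega, (entry_tail_lt_iff w _ _).mpr (hlt.trans h)⟩
    · obtain ⟨i, rfl⟩ := Nat.exists_eq_succ_of_ne_zero hi0.ne'
      exact ⟨i, by omega, (entry_tail_lt_iff w _ _).mpr hlt⟩
  · rintro ⟨k, hk, rfl⟩
    obtain ⟨i, hi, hlt⟩ := mem_nonRecords.mp hk
    exact ⟨i + 1, by omega, (entry_tail_lt_iff w _ _).mp hlt⟩

theorem entry_lowerRecords_zero (w : Equiv.Perm (Fin (n + 1 + 1))) :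
    entry (lowerRecords w) 0 = min (entry w 1) (entry w 0) := by
  rw [entry_lowerRecords w (by omega)]
  simp [prefixMax]

/-- Prepending an entry that is adjacent in value to the following one creates no patterns. -/
theorem avoids_of_avoids_tail {w : Equiv.Perm (Fin (n + 1))} (h1 : Avoids132 (tail w))
    (h2 : Avoids312 (tail w)) (h : entry w 0 = entry w 1 + 1 ∨ entry w 1 = entry w 0 + 1) :
    Avoids132 w ∧ Avoids312 w := by
  rw [avoids132_iff] at h1 ⊢
  rw [avoids312_iff] at h2 ⊢
  have h1' : ∀ i j k, 0 < i → i < j → j < k → entry w i < entry w k → entry w k < entry w j →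
      False := by
    intro i j k hi hij hjk h3 h4
    obtain ⟨i, rfl⟩ := Nat.exists_eq_succ_of_ne_zero (by omega : i ≠ 0)
    obtain ⟨j, rfl⟩ := Nat.exists_eq_succ_of_ne_zero (by omega : j ≠ 0)
    obtain ⟨k, rfl⟩ := Nat.exists_eq_succ_of_ne_zero (by omega : k ≠ 0)
    exact h1 ⟨i, j, k, by omega, by omega, (entry_tail_lt_iff w _ _).mpr h3,
      (entry_tail_lt_iff w _ _).mpr h4⟩
  have h2' : ∀ i j k, 0 < i → i < j → j < k → entry w j < entry w k → entry w k < entry w i →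
      False := by
    intro i j k hi hij hjk h3 h4
    obtain ⟨i, rfl⟩ := Nat.exists_eq_succ_of_ne_zero (by omega : i ≠ 0)
    obtain ⟨j, rfl⟩ := Nat.exists_eq_succ_of_ne_zero (by omega : j ≠ 0)
    obtain ⟨k, rfl⟩ := Nat.exists_eq_succ_of_ne_zero (by omega : k ≠ 0)
    exact h2 ⟨i, j, k, by omega, by omega, (entry_tail_lt_iff w _ _).mpr h3,
      (entry_tail_lt_iff w _ _).mpr h4⟩
  have hne : ∀ k, 1 < k → entry w k ≠ entry w 1 := fun k hk h => by
    have := entry_injective w h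
    omega
  constructor
  · rintro ⟨i, j, k, hij, hjk, h3, h4⟩
    rcases Nat.eq_zero_or_pos i with rfl | hi
    · have := hne k (by omega)
      rcases eq_or_ne j 1 with rfl | hj
      · omega
      · exact h1' 1 j k (by omega) (by omega) hjk (by omega) h4
    · exact h1' i j k hi hij hjk h3 h4
  · rintro ⟨i, j, k, hij, hjk, h3, h4⟩
    rcases Nat.eq_zero_or_pos i with rfl | hi
    · have := hne k (by omega)
      rcases eq_or_ne j 1 with rfl | hj
      · omega
      · exact h2' 1 j k (by omega) (by omega) hjk h3 (by omega)
    · exact h2' i j k hi hij hjk h3 h4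

theorem slice_schubert_card_nonRecords (w : Equiv.Perm (Fin (n + 1))) :
    slice (nonRecords w).card (schubert w) = schubert (lowerRecords w) := by
  rw [slice_schubert_of_ge w le_rfl, if_pos rfl]

/-- The highest power of `x₁` in a polynomial corresponds to the lowest one in its complement. -/
theorem entry_zero_add_card_nonRecords {w v : Equiv.Perm (Fin (n + 1))}
    (h : IsComplementPair (staircase (n + 1)) (schubert w) (schubert v)) :
    entry v 0 + (nonRecords w).card = n := by
  have hw : slice (nonRecords w).card (schubert w) ≠ 0 := by
    rw [slice_schubert_card_nonRecords]; exact schubert_ne_zero _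
  have hv : slice (entry v 0) (schubert v) ≠ 0 := by
    rw [slice_schubert_entry_zero]; exact schubert_ne_zero _
  have h1 := h.le_of_slice_ne_zero hw
  have h2 := h.symm.le_of_slice_ne_zero hv
  have h3 := (h.slice (by omega : (nonRecords w).card + (n - (nonRecords w).card) = n)).right_ne_zero
    hw
  have h4 := (h.symm.slice (by omega : entry v 0 + (n - entry v 0) = n)).right_ne_zero hv
  apply le_antisymm
  · by_contra hlt
    rw [slice_schubert_of_le v (by omega), if_neg (by omega)] at h3
    exact h3 rfl
  · by_contra hlt
    rw [slice_schubert_of_ge w (by omega), if_neg (by omega)] at h4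
    exact h4 rfl

theorem isComplementPair_lowerRecords_tail {w v : Equiv.Perm (Fin (n + 1))}
    (h : IsComplementPair (staircase (n + 1)) (schubert w) (schubert v)) :
    IsComplementPair (staircase n) (schubert (lowerRecords w)) (schubert (tail v)) := by
  rw [← slice_schubert_card_nonRecords, ← slice_schubert_entry_zero]
  exact h.slice (by rw [add_comm]; exact entry_zero_add_card_nonRecords h)

/-- If the complement of `𝔖 w` is some `𝔖 v` with `v ∈ Sₙ`, then `w` avoids both patterns. -/
theorem avoids_of_isComplementPair (w v : Equiv.Perm (Fin n))
    (h : IsComplementPair (staircase n) (schubert w) (schubert v)) :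
    Avoids132 w ∧ Avoids312 w := by
  induction n with
  | zero => exact ⟨fun ⟨i, _⟩ => i.elim0, fun ⟨i, _⟩ => i.elim0⟩
  | succ n ih =>
    cases n with
    | zero => exact ⟨fun ⟨i, j, _, hij, _⟩ => by omega, fun ⟨i, j, _, hij, _⟩ => by omega⟩
    | succ n =>
      have hwv := isComplementPair_lowerRecords_tail h
      have hvw := isComplementPair_lowerRecords_tail h.symm
      have hy := ih _ _ hvw.symm
      have hz := ih _ _ hwv.symm
      -- The first entries and the left-to-right maxima of `w`, `v` and of their first slices
      -- determine each other; the resulting linear relations force `|w 0 - w 1| = 1`.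
      have e1 := entry_zero_add_card_nonRecords h
      have e2 := entry_zero_add_card_nonRecords h.symm
      have e3 := entry_zero_add_card_nonRecords hwv
      have e4 := entry_zero_add_card_nonRecords hvw
      rw [card_nonRecords_of_avoids132 (ih _ _ hwv).1, entry_lowerRecords_zero] at e3
      rw [card_nonRecords_of_avoids132 (ih _ _ hvw).1, entry_lowerRecords_zero] at e4
      have e5 := entry_zero_le_card_nonRecords w
      have e6 : entry w 0 < entry w 1 → (nonRecords w).card = entry (tail w) 0 := fun hlt => by
        rw [card_nonRecords_tail hlt, card_nonRecords_of_avoids132 hy.1]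
      have e7 : entry v 0 < entry v 1 → (nonRecords v).card = entry (tail v) 0 := fun hlt => by
        rw [card_nonRecords_tail hlt, card_nonRecords_of_avoids132 hz.1]
      have t1 := entry_tail w 0
      have t2 := entry_tail v 0
      have n1 := entry_succ_ne_entry_zero w 0
      have n2 := entry_succ_ne_entry_zero v 0
      rw [zero_add] at t1 t2 n1 n2
      apply avoids_of_avoids_tail hy.1 hy.2
      split_ifs at t1 t2 <;> omega

end pairs

end SchubertComplement

theorem theorem1p1 (n : ℕ) (w : Equiv.Perm (Fin n)) :
    (SchubertComplement.IsSchubert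
        (SchubertComplement.complement (SchubertComplement.staircase n)
          (SchubertComplement.schubert w)) ↔
      SchubertComplement.Avoids132 w ∧ SchubertComplement.Avoids312 w) ∧
    (SchubertComplement.IsSchubert
        (SchubertComplement.complement (SchubertComplement.staircase n)
          (SchubertComplement.schubert w)) →
      SchubertComplement.complement (SchubertComplement.staircase n)
          (SchubertComplement.schubert w) =
        algebraMap (MvPolynomial ℕ ℤ) SchubertComplement.RatField
          (SchubertComplement.schubert (SchubertComplement.permComplement w))) := by
  open SchubertComplement in
  have key : IsSchubert (complement (staircase n) (schubert w)) →
      Avoids132 w ∧ Avoids312 w := by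
    rintro ⟨m, v, hv⟩
    have hpair := IsComplementPair.of_complement_eq
      (fun _ => le_staircase_of_coeff_schubert_ne_zero w) hv
    obtain ⟨u, hu⟩ := exists_schubert_eq_of_le_staircase v hpair.le_right
    exact avoids_of_isComplementPair w u (hu ▸ hpair)
  refine ⟨⟨key, fun h => ⟨n, _, SchubertComplement.complement_schubert_of_avoids h.1 h.2⟩⟩,
    fun h => SchubertComplement.complement_schubert_of_avoids (key h).1 (key h).2⟩
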